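/- **Syntax.** Fix a vocabulary consisting of predicate symbols and function symbols with arities and an infinite supply of object symbols ($0$-ary function symbols, which serve both as constants and as variables and may be quantified). FO-formulas are built from the atoms $P(\bar t)$, $t=s$, $\top$, $\bot$ with $\lnot,\land,\lor,\Rightarrow,\Leftrightarrow,\forall x,\exists x$. A *rule* is an expression $\forall\bar x: P(\bar t)\leftarrow\varphi$ with $\varphi$ an FO-formula; its free object symbols are those free in $P(\bar t)$ or $\varphi$ and not among $\bar x$. A *definition* $\Phi$ is a finite set of rules such that no object symbol quantified in front of a rule of $\Phi$ is free in a rule of $\Phi$; the predicates in the heads of its rules are its *defined predicates*, forming the set $\mathrm{def}(\Phi)$. FO(ID)-formulas are built from atoms and definitions with the same connectives and quantifiers. A *sequent* $\Gamma\vdash\Delta$ consists of two finite sets of FO(ID)-formulas. Substitution $[t/x]$ replaces free occurrences and is capture-avoiding (quantified object symbols, also those in front of rules, are renamed where necessary). An occurrence in an FO-formula is *positive* (*negative*) if it is in the scope of an even (odd) number of negations, after unwinding $\Leftrightarrow$ and $\Rightarrow$. **Calculus.** $\mathrm{SC}_{\mathrm{FO(ID)}}$ is the sequent calculus with the rules below;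 a sequent is *provable* if it has a finite proof. * (ax) $\Gamma\vdash\Delta$ if $\Gamma\cap\Delta\ne\emptyset$ or $\bot\in\Gamma$ or $\top\in\Delta$. (wk) From $\Gamma'\vdash\Delta'$ infer $\Gamma\vdash\Delta$ if $\Gamma'\subseteq\Gamma$, $\Delta'\subseteq\Delta$. (subst) From $\Gamma\vdash\Delta$ infer $\Gamma[t/x]\vdash\Delta[t/x]$ if no object symbol that is quantified by $\forall$ or $\exists$ in $\Gamma\cup\Delta$ occurs in $t$. (cut) From $\Gamma\vdash\varphi,\Delta$ and $\Gamma,\varphi\vdash\Delta$ infer $\Gamma\vdash\Delta$. * ($\lnot$L) From $\Gamma\vdash\varphi,\Delta$ infer $\Gamma,\lnot\varphi\vdash\Delta$. ($\lnot$R) From $\Gamma,\varphi\vdash\Delta$ infer $\Gamma\vdash\lnot\varphi,\Delta$. ($\lor$L) From $\Gamma,\varphi\vdash\Delta$ and $\Gamma,\psi\vdash\Delta$ infer $\Gamma,\varphi\lor\psi\vdash\Delta$. ($\lor$R) From $\Gamma\vdash\varphi,\psi,\Delta$ infer $\Gamma\vdash\varphi\lor\psi,\Delta$. ($\land$L) From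 $\Gamma,\varphi,\psi\vdash\Delta$ infer $\Gamma,\varphi\land\psi\vdash\Delta$. ($\land$R) From $\Gamma\vdash\varphi,\Delta$ and $\Gamma\vdash\psi,\Delta$ infer $\Gamma\vdash\varphi\land\psi,\Delta$. ($\Rightarrow$L) From $\Gamma\vdash\varphi,\Delta$ and $\Gamma,\psi\vdash\Delta$ infer $\Gamma,\varphi\Rightarrow\psi\vdash\Delta$. ($\Rightarrow$R) From $\Gamma,\varphi\vdash\psi,\Delta$ infer $\Gamma\vdash\varphi\Rightarrow\psi,\Delta$. ($\Leftrightarrow$L) From $\Gamma\vdash\varphi,\psi,\Delta$ and $\Gamma,\varphi,\psi\vdash\Delta$ infer $\Gamma,\varphi\Leftrightarrow\psi\vdash\Delta$. ($\Leftrightarrow$R) From $\Gamma,\varphi\vdash\psi,\Delta$ and $\Gamma,\psi\vdash\varphi,\Delta$ infer $\Gamma\vdash\varphi\Leftrightarrow\psi,\Delta$. * ($\forall$L) From $\Gamma,\varphi[t/x]\vdash\Delta$ infer $\Gamma,\forall x:\varphi\vdash\Delta$. ($\exists$R) From $\Gamma\vdash\varphi[t/x],\Delta$ infer $\Gamma\vdash\exists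 x:\varphi,\Delta$. If $x$ is not free in $\Gamma\cup\Delta$: ($\forall$R) from $\Gamma\vdash\varphi,\Delta$ infer $\Gamma\vdash\forall x:\varphi,\Delta$; ($\exists$L) from $\Gamma,\varphi\vdash\Delta$ infer $\Gamma,\exists x:\varphi\vdash\Delta$. ($=$L) From $\Gamma[s/x,t/y]\vdash\Delta[s/x,t/y]$ infer $\Gamma[t/x,s/y],t=s\vdash\Delta[t/x,s/y]$, for distinct $x,y$. ($=$R) $\Gamma\vdash t=t,\Delta$. * (def R) From $\Gamma,\Phi\vdash\varphi[\bar s/\bar x],\Delta$ infer $\Gamma,\Phi\vdash P(\bar t[\bar s/\bar x]),\Delta$, where $\forall\bar x:P(\bar t)\leftarrow\varphi$ is a rule of the definition $\Phi$ and $\bar s$ is a tuple of terms. * (def L) Let $\Phi$ be a definition, $P\in\Pi\subseteq\mathrm{def}(\Phi)$, and for each $Q\in\Pi$ let $F_Q$ be an FO-formula and $\bar z_Q$ a tuple of distinct object symbols whose length is the arity of $Q$; write $F_Q[\bar s]$ for $F_Q[\bar s/\bar z_Q]$. Suppose that for every rule $\forall\bar y:Q(\bar s)\leftarrow\psi$ of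 $\Phi$, no symbol of $\bar y$ is free in $\Gamma$, $\Delta$ or $\Phi$ and, if $Q\in\Pi$, no symbol of $\bar y$ is free in a formula $F_R$ $(R\in\Pi)$ unless it is one of $\bar z_R$. From $\Gamma,\Phi,F_P[\bar v]\vdash\Delta$ and the sequents $\Gamma,\Phi,\psi[F_\Pi/\Pi^+]\vdash F_Q[\bar s],\Delta$ for all rules $\forall\bar y:Q(\bar s)\leftarrow\psi$ of $\Phi$ with $Q\in\Pi$, infer $\Gamma,\Phi,P(\bar v)\vdash\Delta$. Here $\psi[F_\Pi/\Pi^+]$ results from $\psi$ by replacing (without capture) every positive occurrence of an atom $R(\bar u)$ with $R\in\Pi$ by $F_R[\bar u]$. **Semantics.** A structure $\mathcal I$ has a non-empty domain $D$ and interprets predicate, function and object symbols. Satisfaction of FO(ID)-formulas is defined as usual, with one clause for $\mathcal I\models\Phi$ for each semantics. For a defined predicate $P$ and $\bar a\in D^n$, the *merged body* $\varphi_{P(\bar a)}$ is the disjunction of the formulas $\exists\bar x:\bar y=\bar t\land\varphi$ over all rules $\forall\bar x:P(\bar t)\leftarrow\varphi$ of $\Phi$, with the fresh symbols $\bar y$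 interpreted by $\bar a$. * *Well-founded:* For three-valued structures (predicates take the values $\mathbf f,\mathbf u,\mathbf t$) formulas are evaluated by Kleene's truth assignment; the precision order is generated by $\mathbf u\le_p\mathbf f$ and $\mathbf u\le_p\mathbf t$. $\mathfrak A'$ is a *$\Phi$-refinement* of $\mathfrak A$ if there is a non-empty set $U$ of defined domain atoms $P(\bar a)$, all unknown in $\mathfrak A$, such that either $\mathfrak A'=\mathfrak A[U:\mathbf t]$ and $\varphi_A^{\mathfrak A}=\mathbf t$ for all $A\in U$, or $\mathfrak A'=\mathfrak A[U:\mathbf f]$ and $\varphi_A^{\mathfrak A'}=\mathbf f$ for all $A\in U$. A *well-founded induction* in a context (an interpretation of the non-defined symbols) is an ordinal-indexed sequence $\langle\mathfrak A_i\rangle_{0\le i\le\beta}$ of three-valued structures extending the context in which all defined atoms are unknown in $\mathfrak A_0$, $\mathfrak A_{i+1}$ is a $\Phi$-refinement of $\mathfrak A_i$, and $\mathfrak A_\lambda$ is the $\le_p$-limit (least upper bound) of the earlier structures at limit ordinals $\lambda$; it is *terminal* if $\mathfrak A_\beta$ has no $\Phi$-refinement. $\mathcal I\models_{\mathrm{wf}}\Phi$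 iff $\mathcal I$ is the limit $\mathfrak A_\beta$ of a terminal well-founded induction of $\Phi$ in the context given by $\mathcal I$. * *Stable:* Let $\mathcal S$ be the set of structures that agree with $\mathcal I$ except possibly on $\mathrm{def}(\Phi)$, ordered by inclusion $\sqsubseteq$ of the defined predicates. For $\mathcal J,\mathcal K\in\mathcal S$ let $\mathcal C(\mathcal J,\mathcal K)\in\mathcal S$ be the structure in which $P(\bar a)$, for defined $P$, is true iff $\varphi_{P(\bar a)}$ is true when positive occurrences of defined predicates are evaluated in $\mathcal J$ and negative ones in $\mathcal K$. $\mathcal I\models_{\mathrm{st}}\Phi$ iff $\mathcal I$ is the least fixpoint of $\mathcal C(\cdot,\mathcal I)$. * *Henkin:* A *Henkin class* for a structure $\mathcal I$ is a family $\mathcal H=(H_k)_{k\in\mathbb N}$ with $H_k\subseteq\mathcal P(D^k)$ such that: $\{(a,a)\mid a\in D\}\in H_2$; $Q^{\mathcal I}\in H_n$ for each $n$-ary predicate symbol $Q$ interpreted by $\mathcal I$; if $R\in H_{k+1}$ and $a\in D$, then $\{\bar b\in D^k\mid(\bar b,a)\in R\}\in H_k$; if $R\in H_k$, $t_1,\dots,t_k$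 are terms, $\bar x=(x_1,\dots,x_n)$ and $\bar y$ are tuples of distinct object symbols without common element and $\bar b$ is a tuple of values for $\bar y$, then $\{\bar a\in D^n\mid\bar t^{\,\mathcal I[\bar x:\bar a,\bar y:\bar b]}\in R\}\in H_n$; each $H_k$ is closed under complement and binary intersection; and if $R\in H_{k+1}$, then $\{\bar b\in D^k\mid(\bar b,a)\in R\text{ for all }a\in D\}\in H_k$. A structure $\mathcal J\in\mathcal S$ is an *$\mathcal H$-point* if $P^{\mathcal J}\in H_n$ for every $n$-ary $P\in\mathrm{def}(\Phi)$. $(\mathcal I,\mathcal H)\models_{\mathrm H}\Phi$ iff $\mathcal I$ is the least pre-fixed $\mathcal H$-point of $\mathcal C(\cdot,\mathcal I)$, i.e. the least $\mathcal H$-point $\mathcal J$ with $\mathcal C(\mathcal J,\mathcal I)\sqsubseteq\mathcal J$. A sequent $\Gamma\vdash\Delta$ is *valid* under the well-founded (stable) semantics if every structure interpreting its symbols satisfies some formula of $\Delta$ or fails some formula of $\Gamma$, and under the Henkin semantics if the same holds for every pair $(\mathcal I,\mathcal H)$ of a structure interpreting its symbols and a Henkin class for it. **Theorem (Soundness).**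 Every $\mathrm{SC}_{\mathrm{FO(ID)}}$-provable sequent is valid under the well-founded semantics, under the stable semantics, and under the Henkin semantics. -/

import Mathlib

namespace FOID

noncomputable section

open scoped Classical

universe u v w d

/-! ## Syntax

The vocabulary consists of a first-order language `L` (predicate and function symbols with their
arities) together with a type `V` of object symbols.  Object symbols are both the constants and the
variables of the logic: they are interpreted by structures and may be quantified. -/

/-- Predicate symbols, bundled with their arity. -/
abbrev PredSym (L : FirstOrder.Language.{u, v}) := Σ n, L.Relations n

/-- Function symbols, bundled with their arity. -/
abbrev FuncSym (L : FirstOrder.Language.{u, v}) := Σ n, L.Functions n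

/-- The object symbols that occur in a term. -/
def tvars {L : FirstOrder.Language.{u, v}} {V : Type w} (t : L.Term V) : Set V := ↑t.varFinset

/-- Formulas over `L` and `V` that may use the elements of `X` as additional atoms. -/
inductive Fml (L : FirstOrder.Language.{u, v}) (V : Type w) (X : Type d) : Type (max u v w d) where
  | top : Fml L V X
  | bot : Fml L V X
  | eq (t s : L.Term V) : Fml L V X
  | rel (R : PredSym L) (ts : Fin R.1 → L.Term V) : Fml L V X
  | ext (e : X) : Fml L V X
  | neg (φ : Fml L V X) : Fml L V X
  | and (φ ψ : Fml L V X) : Fml L V X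
  | or (φ ψ : Fml L V X) : Fml L V X
  | imp (φ ψ : Fml L V X) : Fml L V X
  | iff (φ ψ : Fml L V X) : Fml L V X
  | all (x : V) (φ : Fml L V X) : Fml L V X
  | ex (x : V) (φ : Fml L V X) : Fml L V X

/-- FO-formulas: no additional atoms. -/
abbrev FOFml (L : FirstOrder.Language.{u, v}) (V : Type w) := Fml L V Empty

section Formula

variable {L : FirstOrder.Language.{u, v}} {V : Type w} {X : Type d}

/-- The object symbols that occur freely in a formula, given those of the additional atoms. -/
def Fml.freeWith (fX : X → Set V) : Fml L V X → Set V
  | .top => ∅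
  | .bot => ∅
  | .eq t s => tvars t ∪ tvars s
  | .rel _ ts => ⋃ i, tvars (ts i)
  | .ext e => fX e
  | .neg φ => φ.freeWith fX
  | .and φ ψ => φ.freeWith fX ∪ ψ.freeWith fX
  | .or φ ψ => φ.freeWith fX ∪ ψ.freeWith fX
  | .imp φ ψ => φ.freeWith fX ∪ ψ.freeWith fX
  | .iff φ ψ => φ.freeWith fX ∪ ψ.freeWith fX
  | .all x φ => φ.freeWith fX \ {x}
  | .ex x φ => φ.freeWith fX \ {x}

/-- The object symbols `y` such that `∀ y` or `∃ y` occurs in a formula. -/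
def Fml.quantifiedWith (qX : X → Set V) : Fml L V X → Set V
  | .top => ∅
  | .bot => ∅
  | .eq _ _ => ∅
  | .rel _ _ => ∅
  | .ext e => qX e
  | .neg φ => φ.quantifiedWith qX
  | .and φ ψ => φ.quantifiedWith qX ∪ ψ.quantifiedWith qX
  | .or φ ψ => φ.quantifiedWith qX ∪ ψ.quantifiedWith qX
  | .imp φ ψ => φ.quantifiedWith qX ∪ ψ.quantifiedWith qX
  | .iff φ ψ => φ.quantifiedWith qX ∪ ψ.quantifiedWith qX
  | .all x φ => insert x (φ.quantifiedWith qX)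
  | .ex x φ => insert x (φ.quantifiedWith qX)

/-- `SubstWith fX sX σ φ φ'`: the formula `φ'` results from `φ` by simultaneously replacing every
free occurrence of each object symbol `y` by the term `σ y`, where quantified object symbols are
renamed so that nothing is captured.  It is a relation, so that every admissible choice of new names
is allowed (renaming is permitted, and not performing it is permitted where nothing is captured). -/
inductive Fml.SubstWith (fX : X → Set V) (sX : (V → L.Term V) → X → X → Prop) :
    (V → L.Term V) → Fml L V X → Fml L V X → Prop where
  | top (σ) : SubstWith fX sX σ .top .top
  | bot (σ) : SubstWith fX sX σ .bot .bot
  | eq (σ) (t s : L.Term V) : SubstWith fX sX σ (.eq t s) (.eq (t.subst σ) (s.subst σ))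
  | rel (σ) (R : PredSym L) (ts : Fin R.1 → L.Term V) :
      SubstWith fX sX σ (.rel R ts) (.rel R fun i => (ts i).subst σ)
  | ext (σ) (e e' : X) : sX σ e e' → SubstWith fX sX σ (.ext e) (.ext e')
  | neg (σ) (φ φ' : Fml L V X) : SubstWith fX sX σ φ φ' → SubstWith fX sX σ (.neg φ) (.neg φ')
  | and (σ) (φ φ' ψ ψ' : Fml L V X) : SubstWith fX sX σ φ φ' → SubstWith fX sX σ ψ ψ' →
      SubstWith fX sX σ (.and φ ψ) (.and φ' ψ')
  | or (σ) (φ φ' ψ ψ' : Fml L V X) : SubstWith fX sX σ φ φ' → SubstWith fX sX σ ψ ψ' →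
      SubstWith fX sX σ (.or φ ψ) (.or φ' ψ')
  | imp (σ) (φ φ' ψ ψ' : Fml L V X) : SubstWith fX sX σ φ φ' → SubstWith fX sX σ ψ ψ' →
      SubstWith fX sX σ (.imp φ ψ) (.imp φ' ψ')
  | iff (σ) (φ φ' ψ ψ' : Fml L V X) : SubstWith fX sX σ φ φ' → SubstWith fX sX σ ψ ψ' →
      SubstWith fX sX σ (.iff φ ψ) (.iff φ' ψ')
  | all (σ) (x x' : V) (φ φ' : Fml L V X) :
      (∀ y ∈ φ.freeWith fX, y ≠ x → x' ∉ tvars (σ y)) →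
      SubstWith fX sX (Function.update σ x (.var x')) φ φ' →
      SubstWith fX sX σ (.all x φ) (.all x' φ')
  | ex (σ) (x x' : V) (φ φ' : Fml L V X) :
      (∀ y ∈ φ.freeWith fX, y ≠ x → x' ∉ tvars (σ y)) →
      SubstWith fX sX (Function.update σ x (.var x')) φ φ' →
      SubstWith fX sX σ (.ex x φ) (.ex x' φ')

/-- The free object symbols of an FO-formula. -/
def Fml.foFree (φ : FOFml L V) : Set V := φ.freeWith fun e => e.elim

/-- The quantified object symbols of an FO-formula. -/
def Fml.foQuantified (φ : FOFml L V) : Set V := φ.quantifiedWith fun e => e.elim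

/-- Capture-avoiding simultaneous substitution for FO-formulas. -/
def Fml.FOSubst (σ : V → L.Term V) (φ φ' : FOFml L V) : Prop :=
  φ.SubstWith (fun e => e.elim) (fun _ e _ => e.elim) σ φ'

/-- The predicate symbols with a positive occurrence (`pol = true`) or a negative occurrence
(`pol = false`) in an FO-formula, where `φ ⇔ ψ` is read as `(φ ⇒ ψ) ∧ (ψ ⇒ φ)`
and `φ ⇒ ψ` as `¬ φ ∨ ψ`. -/
def Fml.occ : Bool → FOFml L V → Set (PredSym L)
  | _, .top => ∅
  | _, .bot => ∅
  | _, .eq _ _ => ∅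
  | pol, .rel R _ => {Q | pol = true ∧ Q = R}
  | _, .ext _ => ∅
  | pol, .neg φ => φ.occ (!pol)
  | pol, .and φ ψ => φ.occ pol ∪ ψ.occ pol
  | pol, .or φ ψ => φ.occ pol ∪ ψ.occ pol
  | pol, .imp φ ψ => φ.occ (!pol) ∪ ψ.occ pol
  | pol, .iff φ ψ => φ.occ pol ∪ φ.occ (!pol) ∪ (ψ.occ pol ∪ ψ.occ (!pol))
  | pol, .all _ φ => φ.occ pol
  | pol, .ex _ φ => φ.occ pol

/-- The substitution `[s₁/z₁, …, sₙ/zₙ]`, for distinct object symbols `z₁, …, zₙ`. -/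
def tupleSubst {n : ℕ} (z : Fin n → V) (s : Fin n → L.Term V) : V → L.Term V :=
  Function.extend z s FirstOrder.Language.Term.var

/-- The substitution `[t/x]`. -/
def singleSubst (x : V) (t : L.Term V) : V → L.Term V :=
  Function.update FirstOrder.Language.Term.var x t

/-- The substitution `[t/x, s/y]`, for distinct `x` and `y`. -/
def doubleSubst (x : V) (t : L.Term V) (y : V) (s : L.Term V) : V → L.Term V :=
  Function.update (Function.update FirstOrder.Language.Term.var x t) y s

/-- `ReplPos Π F z true Term.var ψ ψ'` says that `ψ'` is `ψ[F_Π/Π⁺]`: every positive occurrence in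
`ψ` of an atom `R(ū)` with `R ∈ Π` is replaced by `F_R[ū/z_R]`, with quantified object symbols
renamed so that nothing is captured.  For the recursion, `pol` records whether the current subformula
stands in a positive position of the whole formula (`true`) or in a negative one (`false`), and `σ`
records the renaming of the object symbols that are quantified further outside.
Biconditionals in which a predicate of `Π` occurs are unwound first. -/
inductive ReplPos (Pi : Set (PredSym L)) (F : PredSym L → FOFml L V)
    (z : (R : PredSym L) → Fin R.1 → V) :
    Bool → (V → L.Term V) → FOFml L V → FOFml L V → Prop where
  | top (pol σ) : ReplPos Pi F z pol σ .top .top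
  | bot (pol σ) : ReplPos Pi F z pol σ .bot .bot
  | eq (pol σ) (t s : L.Term V) : ReplPos Pi F z pol σ (.eq t s) (.eq (t.subst σ) (s.subst σ))
  | relKeep (pol σ) (R : PredSym L) (ts : Fin R.1 → L.Term V) : pol = false ∨ R ∉ Pi →
      ReplPos Pi F z pol σ (.rel R ts) (.rel R fun i => (ts i).subst σ)
  | relRepl (σ) (R : PredSym L) (ts : Fin R.1 → L.Term V) (χ : FOFml L V) : R ∈ Pi →
      (F R).FOSubst (tupleSubst (z R) fun i => (ts i).subst σ) χ →
      ReplPos Pi F z true σ (.rel R ts) χ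
  | neg (pol σ) (φ φ' : FOFml L V) : ReplPos Pi F z (!pol) σ φ φ' →
      ReplPos Pi F z pol σ (.neg φ) (.neg φ')
  | and (pol σ) (φ φ' ψ ψ' : FOFml L V) : ReplPos Pi F z pol σ φ φ' → ReplPos Pi F z pol σ ψ ψ' →
      ReplPos Pi F z pol σ (.and φ ψ) (.and φ' ψ')
  | or (pol σ) (φ φ' ψ ψ' : FOFml L V) : ReplPos Pi F z pol σ φ φ' → ReplPos Pi F z pol σ ψ ψ' →
      ReplPos Pi F z pol σ (.or φ ψ) (.or φ' ψ')
  | imp (pol σ) (φ φ' ψ ψ' : FOFml L V) : ReplPos Pi F z (!pol) σ φ φ' →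
      ReplPos Pi F z pol σ ψ ψ' → ReplPos Pi F z pol σ (.imp φ ψ) (.imp φ' ψ')
  | iffKeep (pol σ) (φ φ' ψ ψ' : FOFml L V) : (∀ R ∈ Pi, R ∉ (Fml.iff φ ψ).occ true) →
      ReplPos Pi F z pol σ φ φ' → ReplPos Pi F z pol σ ψ ψ' →
      ReplPos Pi F z pol σ (.iff φ ψ) (.iff φ' ψ')
  | iffUnwind (pol σ) (φ ψ χ χ' : FOFml L V) : ReplPos Pi F z pol σ (.imp φ ψ) χ →
      ReplPos Pi F z pol σ (.imp ψ φ) χ' → ReplPos Pi F z pol σ (.iff φ ψ) (.and χ χ')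
  | all (pol σ) (x x' : V) (φ φ' : FOFml L V) :
      (∀ y ∈ φ.foFree, y ≠ x → x' ∉ tvars (σ y)) →
      (∀ R ∈ Pi, R ∈ φ.occ pol → x' ∈ (F R).foFree → x' ∈ Set.range (z R)) →
      ReplPos Pi F z pol (Function.update σ x (.var x')) φ φ' →
      ReplPos Pi F z pol σ (.all x φ) (.all x' φ')
  | ex (pol σ) (x x' : V) (φ φ' : FOFml L V) :
      (∀ y ∈ φ.foFree, y ≠ x → x' ∉ tvars (σ y)) →
      (∀ R ∈ Pi, R ∈ φ.occ pol → x' ∈ (F R).foFree → x' ∈ Set.range (z R)) →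
      ReplPos Pi F z pol (Function.update σ x (.var x')) φ φ' →
      ReplPos Pi F z pol σ (.ex x φ) (.ex x' φ')

end Formula

/-- A definitional rule `∀ x̄ : P(t̄) ← φ`. -/
structure Rule (L : FirstOrder.Language.{u, v}) (V : Type w) where
  bound : List V
  pred : PredSym L
  args : Fin pred.1 → L.Term V
  body : FOFml L V

/-- The object symbols that occur freely in a definitional rule. -/
def Rule.free {L : FirstOrder.Language.{u, v}} {V : Type w} (r : Rule L V) : Set V :=
  ((⋃ i, tvars (r.args i)) ∪ r.body.foFree) \ {x | x ∈ r.bound}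

/-- A definition: a finite set of definitional rules such that no object symbol that is quantified
in front of a rule occurs freely in a rule. -/
structure Definition (L : FirstOrder.Language.{u, v}) (V : Type w) where
  rules : Finset (Rule L V)
  bound_not_free : ∀ r ∈ rules, ∀ r' ∈ rules, ∀ x ∈ r.bound, x ∉ r'.free

/-- FO(ID)-formulas: definitions serve as additional atoms. -/
abbrev IDFml (L : FirstOrder.Language.{u, v}) (V : Type w) := Fml L V (Definition L V)

section Definitions

variable {L : FirstOrder.Language.{u, v}} {V : Type w}

/-- The defined predicates of a definition. -/
def Definition.defined (Φ : Definition L V) : Set (PredSym L) := {R | ∃ r ∈ Φ.rules, r.pred = R}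

/-- The object symbols that occur freely in a definition. -/
def Definition.free (Φ : Definition L V) : Set V := ⋃ r ∈ Φ.rules, r.free

/-- The object symbols quantified in the bodies of the rules of a definition. -/
def Definition.quantified (Φ : Definition L V) : Set V := ⋃ r ∈ Φ.rules, r.body.foQuantified

/-- Capture-avoiding substitution in a definitional rule; `ρ` renames the symbols quantified in
front of the rule. -/
def Rule.Subst (σ : V → L.Term V) (r r' : Rule L V) : Prop :=
  ∃ (ρ : V → V) (body' : FOFml L V),
    let σ' : V → L.Term V := fun y => if y ∈ r.bound then .var (ρ y) else σ y
    Set.InjOn ρ {x | x ∈ r.bound} ∧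
    (∀ x ∈ r.bound, ∀ y ∈ r.free, ρ x ∉ tvars (σ y)) ∧
    r.body.FOSubst σ' body' ∧
    r' = ⟨r.bound.map ρ, r.pred, fun i => (r.args i).subst σ', body'⟩

/-- Capture-avoiding substitution in a definition. -/
def Definition.Subst (σ : V → L.Term V) (Φ Φ' : Definition L V) : Prop :=
  (∀ r ∈ Φ.rules, ∃ r' ∈ Φ'.rules, r.Subst σ r') ∧ (∀ r' ∈ Φ'.rules, ∃ r ∈ Φ.rules, r.Subst σ r')

/-- The free object symbols of an FO(ID)-formula. -/
def Fml.free (φ : IDFml L V) : Set V := φ.freeWith Definition.free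

/-- The quantified object symbols of an FO(ID)-formula. -/
def Fml.quantified (φ : IDFml L V) : Set V := φ.quantifiedWith Definition.quantified

/-- Capture-avoiding simultaneous substitution for FO(ID)-formulas. -/
def Fml.Subst (σ : V → L.Term V) (φ φ' : IDFml L V) : Prop :=
  φ.SubstWith Definition.free Definition.Subst σ φ'

/-- Capture-avoiding simultaneous substitution for finite sets of FO(ID)-formulas. -/
def SubstSet (σ : V → L.Term V) (Γ Γ' : Finset (IDFml L V)) : Prop :=
  (∀ φ ∈ Γ, ∃ φ' ∈ Γ', φ.Subst σ φ') ∧ (∀ φ' ∈ Γ', ∃ φ ∈ Γ, φ.Subst σ φ')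

/-- FO-formulas as FO(ID)-formulas. -/
def Fml.toID : FOFml L V → IDFml L V
  | .top => .top
  | .bot => .bot
  | .eq t s => .eq t s
  | .rel R ts => .rel R ts
  | .ext e => e.elim
  | .neg φ => .neg φ.toID
  | .and φ ψ => .and φ.toID ψ.toID
  | .or φ ψ => .or φ.toID ψ.toID
  | .imp φ ψ => .imp φ.toID ψ.toID
  | .iff φ ψ => .iff φ.toID ψ.toID
  | .all x φ => .all x φ.toID
  | .ex x φ => .ex x φ.toID

/-! ## The sequent calculus -/

/-- `Provable Γ Δ`: the sequent `Γ ⊢ Δ` has a proof in the sequent calculus for FO(ID). -/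
inductive Provable : Finset (IDFml L V) → Finset (IDFml L V) → Prop where
  | ax (Γ Δ) : (∃ φ ∈ Γ, φ ∈ Δ) ∨ .bot ∈ Γ ∨ .top ∈ Δ → Provable Γ Δ
  | wk (Γ Γ' Δ Δ') : Γ' ⊆ Γ → Δ' ⊆ Δ → Provable Γ' Δ' → Provable Γ Δ
  | subst (Γ Γ' Δ Δ') (x : V) (t : L.Term V) :
      (∀ φ ∈ Γ ∪ Δ, ∀ y ∈ φ.quantified, y ∉ tvars t) →
      SubstSet (singleSubst x t) Γ Γ' → SubstSet (singleSubst x t) Δ Δ' →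
      Provable Γ Δ → Provable Γ' Δ'
  | cut (Γ Δ) (φ : IDFml L V) :
      Provable Γ (insert φ Δ) → Provable (insert φ Γ) Δ → Provable Γ Δ
  | negL (Γ Δ) (φ : IDFml L V) :
      Provable Γ (insert φ Δ) → Provable (insert (.neg φ) Γ) Δ
  | negR (Γ Δ) (φ : IDFml L V) :
      Provable (insert φ Γ) Δ → Provable Γ (insert (.neg φ) Δ)
  | orL (Γ Δ) (φ ψ : IDFml L V) :
      Provable (insert φ Γ) Δ → Provable (insert ψ Γ) Δ → Provable (insert (.or φ ψ) Γ) Δ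
  | orR (Γ Δ) (φ ψ : IDFml L V) :
      Provable Γ (insert φ (insert ψ Δ)) → Provable Γ (insert (.or φ ψ) Δ)
  | andL (Γ Δ) (φ ψ : IDFml L V) :
      Provable (insert φ (insert ψ Γ)) Δ → Provable (insert (.and φ ψ) Γ) Δ
  | andR (Γ Δ) (φ ψ : IDFml L V) :
      Provable Γ (insert φ Δ) → Provable Γ (insert ψ Δ) → Provable Γ (insert (.and φ ψ) Δ)
  | impL (Γ Δ) (φ ψ : IDFml L V) :
      Provable Γ (insert φ Δ) → Provable (insert ψ Γ) Δ → Provable (insert (.imp φ ψ) Γ) Δ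
  | impR (Γ Δ) (φ ψ : IDFml L V) :
      Provable (insert φ Γ) (insert ψ Δ) → Provable Γ (insert (.imp φ ψ) Δ)
  | iffL (Γ Δ) (φ ψ : IDFml L V) :
      Provable Γ (insert φ (insert ψ Δ)) → Provable (insert φ (insert ψ Γ)) Δ →
      Provable (insert (.iff φ ψ) Γ) Δ
  | iffR (Γ Δ) (φ ψ : IDFml L V) :
      Provable (insert φ Γ) (insert ψ Δ) → Provable (insert ψ Γ) (insert φ Δ) →
      Provable Γ (insert (.iff φ ψ) Δ)
  | allL (Γ Δ) (x : V) (t : L.Term V) (φ φ' : IDFml L V) : φ.Subst (singleSubst x t) φ' →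
      Provable (insert φ' Γ) Δ → Provable (insert (.all x φ) Γ) Δ
  | allR (Γ Δ) (x : V) (φ : IDFml L V) : (∀ χ ∈ Γ ∪ Δ, x ∉ χ.free) →
      Provable Γ (insert φ Δ) → Provable Γ (insert (.all x φ) Δ)
  | exL (Γ Δ) (x : V) (φ : IDFml L V) : (∀ χ ∈ Γ ∪ Δ, x ∉ χ.free) →
      Provable (insert φ Γ) Δ → Provable (insert (.ex x φ) Γ) Δ
  | exR (Γ Δ) (x : V) (t : L.Term V) (φ φ' : IDFml L V) : φ.Subst (singleSubst x t) φ' →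
      Provable Γ (insert φ' Δ) → Provable Γ (insert (.ex x φ) Δ)
  | eqL (Γ Γ₁ Γ₂ Δ Δ₁ Δ₂) (x y : V) (t s : L.Term V) : x ≠ y →
      SubstSet (doubleSubst x s y t) Γ Γ₁ → SubstSet (doubleSubst x s y t) Δ Δ₁ →
      SubstSet (doubleSubst x t y s) Γ Γ₂ → SubstSet (doubleSubst x t y s) Δ Δ₂ →
      Provable Γ₁ Δ₁ → Provable (insert (.eq t s) Γ₂) Δ₂
  | eqR (Γ Δ) (t : L.Term V) : Provable Γ (insert (.eq t t) Δ)
  /- The substitution `σ` is `[s̄/x̄]`, where `x̄` are the symbols quantified in front of `r`. -/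
  | defR (Γ Δ) (Φ : Definition L V) (r : Rule L V) (σ : V → L.Term V) (φ' : FOFml L V) :
      r ∈ Φ.rules → (∀ y, y ∉ r.bound → σ y = .var y) → r.body.FOSubst σ φ' →
      Provable (insert (.ext Φ) Γ) (insert φ'.toID Δ) →
      Provable (insert (.ext Φ) Γ) (insert (.rel r.pred fun i => (r.args i).subst σ) Δ)
  /- For a rule `r = (∀ ȳ : Q(s̄) ← ψ)`, `B r` is `ψ[F_Π/Π⁺]` and `G r` is `F_Q[s̄]`;
  `FP` is `F_P[v̄]`. -/
  | defL (Γ Δ) (Φ : Definition L V) (Pi : Set (PredSym L)) (F : PredSym L → FOFml L V)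
      (z : (R : PredSym L) → Fin R.1 → V) (B G : Rule L V → FOFml L V)
      (P : PredSym L) (vs : Fin P.1 → L.Term V) (FP : FOFml L V) :
      Pi ⊆ Φ.defined → P ∈ Pi → (∀ R ∈ Pi, Function.Injective (z R)) →
      (∀ r ∈ Φ.rules, ∀ y ∈ r.bound, ∀ χ ∈ insert (.ext Φ) Γ ∪ Δ, y ∉ χ.free) →
      (∀ r ∈ Φ.rules, r.pred ∈ Pi → ∀ y ∈ r.bound, ∀ R ∈ Pi,
        y ∈ (F R).foFree → y ∈ Set.range (z R)) →
      (∀ r ∈ Φ.rules, r.pred ∈ Pi → ReplPos Pi F z true FirstOrder.Language.Term.var r.body (B r)) →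
      (∀ r ∈ Φ.rules, r.pred ∈ Pi → (F r.pred).FOSubst (tupleSubst (z r.pred) r.args) (G r)) →
      (F P).FOSubst (tupleSubst (z P) vs) FP →
      (∀ r ∈ Φ.rules, r.pred ∈ Pi →
        Provable (insert (B r).toID (insert (.ext Φ) Γ)) (insert (G r).toID Δ)) →
      Provable (insert FP.toID (insert (.ext Φ) Γ)) Δ →
      Provable (insert (.rel P vs) (insert (.ext Φ) Γ)) Δ

end Definitions

/-! ## Structures and satisfaction

A structure with domain `D` is given by an interpretation `[L.Structure D]` of the function and
predicate symbols together with an interpretation `val : V → D` of the object symbols.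
Since several interpretations of the predicate symbols are compared below, these are passed around
as the set of the domain atoms that are true. -/

/-- Domain atoms `(P, ā)`. -/
abbrev Atom (L : FirstOrder.Language.{u, v}) (D : Type d) := Σ R : PredSym L, (Fin R.1 → D)

/-- The domain atoms that are true in a structure. -/
def trueAtoms (L : FirstOrder.Language.{u, v}) (D : Type d) [L.Structure D] : Set (Atom L D) :=
  {A | FirstOrder.Language.Structure.RelMap A.1.2 A.2}

section Semantics

variable {L : FirstOrder.Language.{u, v}} {V : Type w} {D : Type d} [L.Structure D]

/-- Two-valued satisfaction, where `p` is the set of the true domain atoms and `e` specifies the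
truth of definitions. -/
def Fml.Sat (p : Set (Atom L D)) (e : Definition L V → (V → D) → Prop) :
    IDFml L V → (V → D) → Prop
  | .top, _ => True
  | .bot, _ => False
  | .eq t s, val => t.realize val = s.realize val
  | .rel R ts, val => (⟨R, fun i => (ts i).realize val⟩ : Atom L D) ∈ p
  | .ext Φ, val => e Φ val
  | .neg φ, val => ¬ φ.Sat p e val
  | .and φ ψ, val => φ.Sat p e val ∧ ψ.Sat p e val
  | .or φ ψ, val => φ.Sat p e val ∨ ψ.Sat p e val
  | .imp φ ψ, val => φ.Sat p e val → ψ.Sat p e val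
  | .iff φ ψ, val => φ.Sat p e val ↔ ψ.Sat p e val
  | .all x φ, val => ∀ a : D, φ.Sat p e (Function.update val x a)
  | .ex x φ, val => ∃ a : D, φ.Sat p e (Function.update val x a)

/-- Satisfaction of FO-formulas where the positive occurrences of predicate symbols are evaluated
in `p` and the negative occurrences in `q`. -/
def Fml.PairSat : Set (Atom L D) → Set (Atom L D) → FOFml L V → (V → D) → Prop
  | _, _, .top, _ => True
  | _, _, .bot, _ => False
  | _, _, .eq t s, val => t.realize val = s.realize val
  | p, _, .rel R ts, val => (⟨R, fun i => (ts i).realize val⟩ : Atom L D) ∈ p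
  | _, _, .ext e, _ => e.elim
  | p, q, .neg φ, val => ¬ φ.PairSat q p val
  | p, q, .and φ ψ, val => φ.PairSat p q val ∧ ψ.PairSat p q val
  | p, q, .or φ ψ, val => φ.PairSat p q val ∨ ψ.PairSat p q val
  | p, q, .imp φ ψ, val => φ.PairSat q p val → ψ.PairSat p q val
  | p, q, .iff φ ψ, val =>
      (φ.PairSat q p val → ψ.PairSat p q val) ∧ (ψ.PairSat q p val → φ.PairSat p q val)
  | p, q, .all x φ, val => ∀ a : D, φ.PairSat p q (Function.update val x a)
  | p, q, .ex x φ, val => ∃ a : D, φ.PairSat p q (Function.update val x a)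

/-- The domain atom to which the head of a rule evaluates. -/
def Rule.headAtom (r : Rule L V) (val : V → D) : Atom L D :=
  ⟨r.pred, fun i => (r.args i).realize val⟩

/-- `IsInstance r val val'`: `val'` differs from `val` at most in the values of the object symbols
that are quantified in front of the rule `r`. -/
def Rule.IsInstance (r : Rule L V) (val val' : V → D) : Prop := ∀ y, y ∉ r.bound → val' y = val y

/-! ### Well-founded semantics -/

/-- The truth values false, unknown and true. -/
inductive TV where
  | f | u | t

/-- Negation of truth values. -/
def TV.neg : TV → TV
  | .f => .t
  | .u => .u
  | .t => .f

/-- The minimum of two truth values in the truth order. -/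
def TV.and : TV → TV → TV
  | .f, _ => .f
  | _, .f => .f
  | .t, .t => .t
  | _, _ => .u

/-- The minimum in the truth order of a family of truth values. -/
def TV.all {ι : Type*} (g : ι → TV) : TV :=
  if ∃ i, g i = .f then .f else if ∃ i, g i = .u then .u else .t

/-- The maximum of two truth values in the truth order. -/
def TV.or (a b : TV) : TV := (a.neg.and b.neg).neg

/-- The maximum in the truth order of a family of truth values. -/
def TV.ex {ι : Type*} (g : ι → TV) : TV := (TV.all fun i => (g i).neg).neg

/-- A proposition as a truth value. -/
def TV.ofProp (P : Prop) : TV := if P then .t else .f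

/-- The precision order. -/
def TV.PrecLE (a b : TV) : Prop := a = .u ∨ a = b

/-- Kleene's truth assignment; `A` is a three-valued interpretation of the predicate symbols. -/
def Fml.value (A : Atom L D → TV) : FOFml L V → (V → D) → TV
  | .top, _ => .t
  | .bot, _ => .f
  | .eq t s, val => TV.ofProp (t.realize val = s.realize val)
  | .rel R ts, val => A ⟨R, fun i => (ts i).realize val⟩
  | .ext e, _ => e.elim
  | .neg φ, val => (φ.value A val).neg
  | .and φ ψ, val => (φ.value A val).and (ψ.value A val)
  | .or φ ψ, val => (φ.value A val).or (ψ.value A val)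
  | .imp φ ψ, val => (φ.value A val).neg.or (ψ.value A val)
  | .iff φ ψ, val =>
      ((φ.value A val).neg.or (ψ.value A val)).and ((ψ.value A val).neg.or (φ.value A val))
  | .all x φ, val => TV.all fun a : D => φ.value A (Function.update val x a)
  | .ex x φ, val => TV.ex fun a : D => φ.value A (Function.update val x a)

/-- The truth value of the merged body of the domain atom `P(ā)`, i.e. of the disjunction of the
formulas `∃ x̄ : ȳ = t̄ ∧ φ` over the rules `∀ x̄ : P(t̄) ← φ` of `Φ`, where `ȳ` has the value `ā`.
(A rule for another predicate than `P` contributes the value false.) -/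
def Definition.bodyValue (Φ : Definition L V) (A : Atom L D → TV) (val : V → D) (a : Atom L D) :
    TV :=
  TV.ex fun i : {i : Rule L V × (V → D) // i.1 ∈ Φ.rules ∧ i.1.IsInstance val i.2} =>
    (TV.ofProp (i.1.1.headAtom i.1.2 = a)).and (i.1.1.body.value A i.1.2)

/-- The interpretation that agrees with `A` outside `U` and has the value `b` on `U`. -/
def setOn (A : Atom L D → TV) (U : Set (Atom L D)) (b : TV) : Atom L D → TV :=
  fun a => if a ∈ U then b else A a

/-- `A'` is a `Φ`-refinement of `A`. -/
def Definition.IsRefinement (Φ : Definition L V) (val : V → D) (A A' : Atom L D → TV) : Prop :=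
  ∃ U : Set (Atom L D), U.Nonempty ∧ (∀ a ∈ U, a.1 ∈ Φ.defined ∧ A a = .u) ∧
    ((A' = setOn A U .t ∧ ∀ a ∈ U, Φ.bodyValue A val a = .t) ∨
      (A' = setOn A U .f ∧ ∀ a ∈ U, Φ.bodyValue A' val a = .f))

/-- A well-founded induction `(A i)`, `0 ≤ i ≤ β`, of `Φ`, in the context in which `p` interprets the
predicate symbols that are not defined and `val` the object symbols. -/
structure Definition.IsWFInduction (Φ : Definition L V) (p : Set (Atom L D)) (val : V → D)
    (β : Ordinal.{max v d}) (A : Ordinal.{max v d} → Atom L D → TV) : Prop where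
  extends_context : ∀ i ≤ β, ∀ a : Atom L D, a.1 ∉ Φ.defined → A i a = TV.ofProp (a ∈ p)
  zero : ∀ a : Atom L D, a.1 ∈ Φ.defined → A 0 a = .u
  succ : ∀ i < β, Φ.IsRefinement val (A i) (A (Order.succ i))
  /- at limits: the least upper bound in the precision order -/
  limit : ∀ l ≤ β, Order.IsSuccLimit l →
    (∀ i < l, ∀ a, (A i a).PrecLE (A l a)) ∧
    ∀ B : Atom L D → TV, (∀ i < l, ∀ a, (A i a).PrecLE (B a)) → ∀ a, (A l a).PrecLE (B a)

/-- The structure is the (two-valued) well-founded model of `Φ`, in the context that the structure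
itself provides: it is the limit of a terminal well-founded induction. -/
def Definition.WFModel (Φ : Definition L V) (p : Set (Atom L D)) (val : V → D) : Prop :=
  ∃ (β : Ordinal.{max v d}) (A : Ordinal.{max v d} → Atom L D → TV),
    Φ.IsWFInduction p val β A ∧ (¬ ∃ A', Φ.IsRefinement val (A β) A') ∧
    ∀ a, A β a = TV.ofProp (a ∈ p)

/-! ### Stable semantics -/

/-- The structure space: the interpretations of the predicate symbols that agree with `p` on the
predicate symbols that are not defined. -/
def Definition.space (Φ : Definition L V) (p : Set (Atom L D)) : Set (Set (Atom L D)) :=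
  {q | ∀ a : Atom L D, a.1 ∉ Φ.defined → (a ∈ q ↔ a ∈ p)}

/-- The operator `C(I, J)`, in the context given by `p` and `val`: a defined domain atom is true in
`C(I, J)` iff its merged body is true when positive occurrences of the defined predicates are
evaluated in `I` and negative occurrences in `J`. -/
def Definition.op (Φ : Definition L V) (p : Set (Atom L D)) (val : V → D) (I J : Set (Atom L D)) :
    Set (Atom L D) :=
  {a | (a.1 ∈ Φ.defined ∧ ∃ r ∈ Φ.rules, ∃ val', r.IsInstance val val' ∧
        r.headAtom val' = a ∧ r.body.PairSat I J val') ∨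
      (a.1 ∉ Φ.defined ∧ a ∈ p)}

/-- The structure is a stable model of `Φ`: it is the least fixpoint of `C(·, p)`. -/
def Definition.StableModel (Φ : Definition L V) (p : Set (Atom L D)) (val : V → D) : Prop :=
  IsLeast {q | q ∈ Φ.space p ∧ Φ.op p val q p = q} p

/-! ### Henkin semantics -/

/-- The predicate and function symbols that a structure interprets.  Only Henkin classes depend on
this choice: a Henkin class has to be closed under the interpreted symbols only. -/
structure Voc (L : FirstOrder.Language.{u, v}) where
  preds : Set (PredSym L)
  funcs : Set (FuncSym L)

/-- All function symbols of the term belong to the vocabulary. -/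
def TermOver (S : Voc L) : L.Term V → Prop
  | .var _ => True
  | .func f ts => (⟨_, f⟩ : FuncSym L) ∈ S.funcs ∧ ∀ i, TermOver S (ts i)

/-- All predicate and function symbols of the formula belong to the vocabulary. -/
def Fml.OverWith {X : Type*} (S : Voc L) (oX : X → Prop) : Fml L V X → Prop
  | .top => True
  | .bot => True
  | .eq t s => TermOver S t ∧ TermOver S s
  | .rel R ts => R ∈ S.preds ∧ ∀ i, TermOver S (ts i)
  | .ext e => oX e
  | .neg φ => φ.OverWith S oX
  | .and φ ψ => φ.OverWith S oX ∧ ψ.OverWith S oX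
  | .or φ ψ => φ.OverWith S oX ∧ ψ.OverWith S oX
  | .imp φ ψ => φ.OverWith S oX ∧ ψ.OverWith S oX
  | .iff φ ψ => φ.OverWith S oX ∧ ψ.OverWith S oX
  | .all _ φ => φ.OverWith S oX
  | .ex _ φ => φ.OverWith S oX

/-- All predicate and function symbols of the definition belong to the vocabulary. -/
def Definition.Over (S : Voc L) (Φ : Definition L V) : Prop :=
  ∀ r ∈ Φ.rules, r.pred ∈ S.preds ∧ (∀ i, TermOver S (r.args i)) ∧
    r.body.OverWith S fun e => e.elim

/-- All predicate and function symbols of the FO(ID)-formula belong to the vocabulary. -/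
def Fml.Over (S : Voc L) (φ : IDFml L V) : Prop := φ.OverWith S (Definition.Over S)

/-- `H` is a Henkin class for the structure with vocabulary `S` in which `p` is the set of the true
domain atoms.  In `terms`, the values of the object symbols other than `x₁, …, xₙ` are arbitrary. -/
structure IsHenkinClass (V : Type w) (S : Voc L) (p : Set (Atom L D))
    (H : (k : ℕ) → Set (Set (Fin k → D))) : Prop where
  equality : {a : Fin 2 → D | a 0 = a 1} ∈ H 2
  predicate : ∀ Q ∈ S.preds, {a : Fin Q.1 → D | (⟨Q, a⟩ : Atom L D) ∈ p} ∈ H Q.1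
  section_last : ∀ k, ∀ R ∈ H (k + 1), ∀ a : D,
    {b : Fin k → D | (Fin.snoc b a : Fin (k + 1) → D) ∈ R} ∈ H k
  terms : ∀ k n, ∀ R ∈ H k, ∀ t : Fin k → L.Term V, (∀ i, TermOver S (t i)) →
    ∀ x : Fin n → V, Function.Injective x → ∀ val : V → D,
      {a : Fin n → D | (fun i => (t i).realize (Function.extend x a val)) ∈ R} ∈ H n
  compl : ∀ k, ∀ R ∈ H k, Rᶜ ∈ H k
  inter : ∀ k, ∀ R ∈ H k, ∀ R' ∈ H k, R ∩ R' ∈ H k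
  forall_last : ∀ k, ∀ R ∈ H (k + 1),
    {b : Fin k → D | ∀ a : D, (Fin.snoc b a : Fin (k + 1) → D) ∈ R} ∈ H k

/-- `q` interprets all defined predicates of `Φ` by relations in `H`. -/
def Definition.IsPoint (Φ : Definition L V) (H : (k : ℕ) → Set (Set (Fin k → D)))
    (q : Set (Atom L D)) : Prop :=
  ∀ P ∈ Φ.defined, {a : Fin P.1 → D | (⟨P, a⟩ : Atom L D) ∈ q} ∈ H P.1

/-- The structure together with `H` is a Henkin model of `Φ`: it is the least pre-fixed `H`-point
of `C(·, p)`. -/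
def Definition.HenkinModel (H : (k : ℕ) → Set (Set (Fin k → D))) (Φ : Definition L V)
    (p : Set (Atom L D)) (val : V → D) : Prop :=
  IsLeast {q | q ∈ Φ.space p ∧ Φ.IsPoint H q ∧ Φ.op p val q p ⊆ q} p

/-! ### Validity of sequents -/

/-- A sequent is true if a formula on the right is true or a formula on the left is not. -/
def SequentSat (sat : IDFml L V → Prop) (Γ Δ : Finset (IDFml L V)) : Prop :=
  (∃ φ ∈ Δ, sat φ) ∨ ∃ φ ∈ Γ, ¬ sat φ

end Semantics

/-- Validity of a sequent under the well-founded semantics. -/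
def WFValid {L : FirstOrder.Language.{u, v}} {V : Type w} (Γ Δ : Finset (IDFml L V)) : Prop :=
  ∀ (D : Type d) [L.Structure D] (val : V → D),
    SequentSat (fun φ => φ.Sat (trueAtoms L D)
      (fun Φ val' => Φ.WFModel (trueAtoms L D) val') val) Γ Δ

/-- Validity of a sequent under the stable semantics. -/
def StableValid {L : FirstOrder.Language.{u, v}} {V : Type w} (Γ Δ : Finset (IDFml L V)) : Prop :=
  ∀ (D : Type d) [L.Structure D] (val : V → D),
    SequentSat (fun φ => φ.Sat (trueAtoms L D)
      (fun Φ val' => Φ.StableModel (trueAtoms L D) val') val) Γ Δ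

/-- Validity of a sequent under the Henkin semantics: truth in all Henkin structures that interpret
the symbols of the sequent. -/
def HenkinValid {L : FirstOrder.Language.{u, v}} {V : Type w} (Γ Δ : Finset (IDFml L V)) : Prop :=
  ∀ (D : Type d) [L.Structure D] (val : V → D) (S : Voc L) (H : (k : ℕ) → Set (Set (Fin k → D))),
    (∀ φ ∈ Γ ∪ Δ, φ.Over S) → IsHenkinClass V S (trueAtoms L D) H →
    SequentSat (fun φ => φ.Sat (trueAtoms L D)
      (fun Φ val' => Φ.HenkinModel H (trueAtoms L D) val') val) Γ Δ

end

end FOID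

/-! All three semantics are handled by one induction on proofs, because soundness needs only the
three properties collected in `AdequateSemantics`. First, the truth of a definition depends only on
its ground instances (head atom and body as a predicate of a pair of interpretations); this gives
coincidence and substitution for FO(ID)-formulas. Second, a model `p` is a pre-fixed point of `C(·,
p)`; this is what (def R) uses. Third, `p` lies inside the interpretation given by the formulas `F`
as soon as its intersection with that interpretation is a pre-fixed point; this is what (def L)
uses. `Provable.sound` draws the conclusion.

For (def L), `ReplPos.pairSat` says that `ψ[F_Π/Π⁺]` expresses the truth of `ψ` when its positive
occurrences of Π are read by `F`. The minor premises then show that the rules for Π lead from the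
intersection back into `F`. The intersection with `p` is taken because defined predicates outside Π
have rules too: larger values of Π could make them derive atoms that are not in `p`.

The third property is where the semantics differ. For stable models it is Knaster–Tarski. For
well-founded models, every atom that becomes true along the induction lies in each pre-fixed point
of the structure space, while stages made false supply the second property. For Henkin models the
intersection must be an `H`-point, which holds because relations definable with parameters belong to
`H` (`IsHenkinClass.definable_mem`).

One gap remains for Henkin models: a proof may pass through symbols absent from its end sequent, and
`H` need not be closed under those. They are reinterpreted trivially, which makes `H` a Henkin class
for the full vocabulary without affecting the end sequent (`IsHenkinClass.reinterpret`,
`Provable.henkinValid`). -/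

namespace FOID

noncomputable section

open scoped Classical
open FirstOrder.Language (Term)

universe u v w d

/-! ### Coincidence, substitution and monotonicity of evaluation. -/

section Coincidence

variable {L : FirstOrder.Language.{u, v}} {V : Type w} {D : Type d}

theorem tvars_var (x : V) : tvars (.var x : L.Term V) = {x} := by
  simp [tvars, Term.varFinset]

theorem tvars_func {n : ℕ} (f : L.Functions n) (ts : Fin n → L.Term V) :
    tvars (.func f ts) = ⋃ i, tvars (ts i) := by
  ext; simp [tvars, Term.varFinset]

theorem finite_tvars (t : L.Term V) : (tvars t).Finite := Finset.finite_toSet _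

variable [L.Structure D]

theorem realize_congr {t : L.Term V} {v v' : V → D} (h : ∀ y ∈ tvars t, v y = v' y) :
    t.realize v = t.realize v' := by
  induction t with
  | var x => exact h x (by simp [tvars_var])
  | func f ts ih =>
    simp only [Term.realize]
    congr 1
    funext i
    exact ih i fun y hy => h y (by rw [tvars_func]; exact Set.mem_iUnion.2 ⟨i, hy⟩)

theorem update_congr_of_diff {S : Set V} {x : V} {v v' : V → D} (h : ∀ y ∈ S \ {x}, v y = v' y)
    (a : D) : ∀ y ∈ S, Function.update v x a y = Function.update v' x a y := by
  intro y hy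
  by_cases hx : y = x
  · subst hx; simp
  · simpa [hx] using h y ⟨hy, hx⟩

/-- Since `x'` is absent from the terms substituted for the other symbols of `S`, giving it a new
value changes only what is substituted for `x`. This is the semantic content of capture avoidance,
used in every quantifier case below. -/
theorem realize_update_fresh {S : Set V} {σ : V → L.Term V} {x x' : V}
    (h : ∀ y ∈ S, y ≠ x → x' ∉ tvars (σ y)) (v : V → D) (a : D) :
    ∀ y ∈ S, (Function.update σ x (.var x') y).realize (Function.update v x' a) =
      Function.update (fun y => (σ y).realize v) x a y := by
  intro y hy
  by_cases hx : y = x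
  · subst hx; simp
  · simp only [ne_eq, hx, not_false_eq_true, Function.update_of_ne]
    refine realize_congr fun z hz => Function.update_of_ne ?_ _ _
    rintro rfl
    exact h y hy hx hz

theorem Fml.pairSat_congr (φ : FOFml L V) : ∀ {p q : Set (Atom L D)} {v v' : V → D},
    (∀ y ∈ φ.foFree, v y = v' y) → (φ.PairSat p q v ↔ φ.PairSat p q v') := by
  induction φ with
  | top => intros; rfl
  | bot => intros; rfl
  | eq t s =>
    intro p q v v' h
    simp only [Fml.PairSat]
    rw [realize_congr fun y hy => h y (Or.inl hy), realize_congr fun y hy => h y (Or.inr hy)]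
  | rel R ts =>
    intro p q v v' h
    simp only [Fml.PairSat]
    have : ∀ i, (ts i).realize v = (ts i).realize v' := fun i =>
      realize_congr fun y hy => h y (Set.mem_iUnion.2 ⟨i, hy⟩)
    simp only [this]
  | ext e => exact e.elim
  | neg φ ih =>
    intro p q v v' h
    simp only [Fml.PairSat]
    rw [ih h]
  | and φ ψ ih₁ ih₂ =>
    intro p q v v' h
    simp only [Fml.PairSat]
    rw [ih₁ fun y hy => h y (Or.inl hy), ih₂ fun y hy => h y (Or.inr hy)]
  | or φ ψ ih₁ ih₂ =>
    intro p q v v' h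
    simp only [Fml.PairSat]
    rw [ih₁ fun y hy => h y (Or.inl hy), ih₂ fun y hy => h y (Or.inr hy)]
  | imp φ ψ ih₁ ih₂ =>
    intro p q v v' h
    simp only [Fml.PairSat]
    rw [ih₁ fun y hy => h y (Or.inl hy), ih₂ fun y hy => h y (Or.inr hy)]
  | iff φ ψ ih₁ ih₂ =>
    intro p q v v' h
    have h₁ : ∀ y ∈ φ.foFree, v y = v' y := fun y hy => h y (Or.inl hy)
    have h₂ : ∀ y ∈ ψ.foFree, v y = v' y := fun y hy => h y (Or.inr hy)
    simp only [Fml.PairSat]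
    rw [@ih₁ p q v v' h₁, @ih₁ q p v v' h₁, @ih₂ p q v v' h₂, @ih₂ q p v v' h₂]
  | all x φ ih =>
    intro p q v v' h
    exact forall_congr' fun a => ih (update_congr_of_diff h a)
  | ex x φ ih =>
    intro p q v v' h
    exact exists_congr fun a => ih (update_congr_of_diff h a)

theorem Fml.FOSubst.pairSat {σ : V → L.Term V} {φ φ' : FOFml L V} (h : φ.FOSubst σ φ') :
    ∀ {p q : Set (Atom L D)} {v : V → D},
      φ'.PairSat p q v ↔ φ.PairSat p q fun y => (σ y).realize v := by
  unfold Fml.FOSubst at h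
  induction h with
  | top => intros; rfl
  | bot => intros; rfl
  | eq => intros; simp only [Fml.PairSat, Term.realize_subst]
  | rel => intros; simp only [Fml.PairSat, Term.realize_subst]
  | ext _ e => exact e.elim
  | neg _ _ _ _ ih => intros; simp only [Fml.PairSat, ih]
  | and _ _ _ _ _ _ _ ih₁ ih₂ => intros; simp only [Fml.PairSat, ih₁, ih₂]
  | or _ _ _ _ _ _ _ ih₁ ih₂ => intros; simp only [Fml.PairSat, ih₁, ih₂]
  | imp _ _ _ _ _ _ _ ih₁ ih₂ => intros; simp only [Fml.PairSat, ih₁, ih₂]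
  | iff _ _ _ _ _ _ _ ih₁ ih₂ => intros; simp only [Fml.PairSat, ih₁, ih₂]
  | all σ x x' φ φ' hf _ ih =>
    intro p q v
    exact forall_congr' fun a => ih.trans (φ.pairSat_congr (realize_update_fresh hf v a))
  | ex σ x x' φ φ' hf _ ih =>
    intro p q v
    exact exists_congr fun a => ih.trans (φ.pairSat_congr (realize_update_fresh hf v a))

theorem Fml.sat_congr {p : Set (Atom L D)} {e : Definition L V → (V → D) → Prop}
    (he : ∀ (Φ : Definition L V) (v v' : V → D), (∀ y ∈ Φ.free, v y = v' y) → (e Φ v ↔ e Φ v'))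
    (φ : IDFml L V) : ∀ {v v' : V → D},
    (∀ y ∈ φ.free, v y = v' y) → (φ.Sat p e v ↔ φ.Sat p e v') := by
  induction φ with
  | top => intros; rfl
  | bot => intros; rfl
  | eq t s =>
    intro v v' h
    simp only [Fml.Sat]
    rw [realize_congr fun y hy => h y (Or.inl hy), realize_congr fun y hy => h y (Or.inr hy)]
  | rel R ts =>
    intro v v' h
    simp only [Fml.Sat]
    have : ∀ i, (ts i).realize v = (ts i).realize v' := fun i =>
      realize_congr fun y hy => h y (Set.mem_iUnion.2 ⟨i, hy⟩)
    simp only [this]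
  | ext Φ => intro v v' h; exact he Φ v v' h
  | neg φ ih =>
    intro v v' h
    simp only [Fml.Sat]
    rw [ih h]
  | and φ ψ ih₁ ih₂ =>
    intro v v' h
    simp only [Fml.Sat]
    rw [ih₁ fun y hy => h y (Or.inl hy), ih₂ fun y hy => h y (Or.inr hy)]
  | or φ ψ ih₁ ih₂ =>
    intro v v' h
    simp only [Fml.Sat]
    rw [ih₁ fun y hy => h y (Or.inl hy), ih₂ fun y hy => h y (Or.inr hy)]
  | imp φ ψ ih₁ ih₂ =>
    intro v v' h
    simp only [Fml.Sat]
    rw [ih₁ fun y hy => h y (Or.inl hy), ih₂ fun y hy => h y (Or.inr hy)]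
  | iff φ ψ ih₁ ih₂ =>
    intro v v' h
    simp only [Fml.Sat]
    rw [ih₁ fun y hy => h y (Or.inl hy), ih₂ fun y hy => h y (Or.inr hy)]
  | all x φ ih =>
    intro v v' h
    exact forall_congr' fun a => ih (update_congr_of_diff h a)
  | ex x φ ih =>
    intro v v' h
    exact exists_congr fun a => ih (update_congr_of_diff h a)

/-- Definitions are treated as atoms: their semantics enters only through `he` and `hs`, so one
proof serves all three semantics. -/
theorem Fml.Subst.sat {p : Set (Atom L D)} {e : Definition L V → (V → D) → Prop}
    (he : ∀ (Φ : Definition L V) (v v' : V → D), (∀ y ∈ Φ.free, v y = v' y) → (e Φ v ↔ e Φ v'))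
    (hs : ∀ (σ : V → L.Term V) (Φ Φ' : Definition L V), Φ.Subst σ Φ' →
      ∀ v : V → D, e Φ' v ↔ e Φ fun y => (σ y).realize v)
    {σ : V → L.Term V} {φ φ' : IDFml L V} (h : φ.Subst σ φ') :
    ∀ {v : V → D}, φ'.Sat p e v ↔ φ.Sat p e fun y => (σ y).realize v := by
  unfold Fml.Subst at h
  induction h with
  | top => intros; rfl
  | bot => intros; rfl
  | eq => intros; simp only [Fml.Sat, Term.realize_subst]
  | rel => intros; simp only [Fml.Sat, Term.realize_subst]
  | ext σ Φ Φ' h => intro v; exact hs σ Φ Φ' h v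
  | neg _ _ _ _ ih => intros; simp only [Fml.Sat, ih]
  | and _ _ _ _ _ _ _ ih₁ ih₂ => intros; simp only [Fml.Sat, ih₁, ih₂]
  | or _ _ _ _ _ _ _ ih₁ ih₂ => intros; simp only [Fml.Sat, ih₁, ih₂]
  | imp _ _ _ _ _ _ _ ih₁ ih₂ => intros; simp only [Fml.Sat, ih₁, ih₂]
  | iff _ _ _ _ _ _ _ ih₁ ih₂ => intros; simp only [Fml.Sat, ih₁, ih₂]
  | all σ x x' φ φ' hf _ ih =>
    intro v
    exact forall_congr' fun a => ih.trans (φ.sat_congr he (realize_update_fresh hf v a))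
  | ex σ x x' φ φ' hf _ ih =>
    intro v
    exact exists_congr fun a => ih.trans (φ.sat_congr he (realize_update_fresh hf v a))

/-- Links the two evaluations in play: sequents use `Sat`, operators use `PairSat`, and polarity is
immaterial when both interpretations coincide. -/
theorem Fml.sat_toID (φ : FOFml L V) {p : Set (Atom L D)}
    {e : Definition L V → (V → D) → Prop} :
    ∀ {v : V → D}, φ.toID.Sat p e v ↔ φ.PairSat p p v := by
  induction φ with
  | ext e => exact e.elim
  | iff φ ψ ih₁ ih₂ => intro v; simp only [Fml.toID, Fml.Sat, Fml.PairSat, ih₁, ih₂, iff_def]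
  | _ => intros; simp_all only [Fml.toID, Fml.Sat, Fml.PairSat]

theorem Fml.pairSat_mono (φ : FOFml L V) : ∀ {p p' q q' : Set (Atom L D)} {v : V → D},
    p ⊆ p' → q' ⊆ q → φ.PairSat p q v → φ.PairSat p' q' v := by
  induction φ with
  | top => intro _ _ _ _ _ _ _ h; exact h
  | bot => intro _ _ _ _ _ _ _ h; exact h
  | eq => intro _ _ _ _ _ _ _ h; exact h
  | rel => intro _ _ _ _ _ hp _ h; exact hp h
  | ext e => exact e.elim
  | neg φ ih => intro _ _ _ _ _ hp hq h h'; exact h (ih hq hp h')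
  | and φ ψ ih₁ ih₂ => intro _ _ _ _ _ hp hq h; exact ⟨ih₁ hp hq h.1, ih₂ hp hq h.2⟩
  | or φ ψ ih₁ ih₂ => intro _ _ _ _ _ hp hq h; exact h.imp (ih₁ hp hq) (ih₂ hp hq)
  | imp φ ψ ih₁ ih₂ => intro _ _ _ _ _ hp hq h h'; exact ih₂ hp hq (h (ih₁ hq hp h'))
  | iff φ ψ ih₁ ih₂ =>
    intro _ _ _ _ _ hp hq h
    exact ⟨fun h' => ih₂ hp hq (h.1 (ih₁ hq hp h')), fun h' => ih₁ hp hq (h.2 (ih₂ hq hp h'))⟩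
  | all x φ ih => intro _ _ _ _ _ hp hq h a; exact ih hp hq (h a)
  | ex x φ ih => intro _ _ _ _ _ hp hq h; exact h.imp fun a => ih hp hq

end Coincidence

/-! ### Kleene evaluation as evaluation in a pair of interpretations. -/

section Kleene

variable {L : FirstOrder.Language.{u, v}} {V : Type w} {D : Type d} [L.Structure D]

theorem TV.neg_eq_t {a : TV} : a.neg = .t ↔ a = .f := by cases a <;> simp [TV.neg]

theorem TV.neg_eq_f {a : TV} : a.neg = .f ↔ a = .t := by cases a <;> simp [TV.neg]

theorem TV.and_eq_t {a b : TV} : a.and b = .t ↔ a = .t ∧ b = .t := by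
  cases a <;> cases b <;> simp [TV.and]

theorem TV.and_eq_f {a b : TV} : a.and b = .f ↔ a = .f ∨ b = .f := by
  cases a <;> cases b <;> simp [TV.and]

theorem TV.or_eq_t {a b : TV} : a.or b = .t ↔ a = .t ∨ b = .t := by
  simp [TV.or, TV.neg_eq_t, TV.and_eq_f, TV.neg_eq_f]

theorem TV.or_eq_f {a b : TV} : a.or b = .f ↔ a = .f ∧ b = .f := by
  simp [TV.or, TV.neg_eq_f, TV.and_eq_t, TV.neg_eq_t]

theorem TV.all_eq_f {ι : Type*} {g : ι → TV} : TV.all g = .f ↔ ∃ i, g i = .f := by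
  unfold TV.all; split_ifs <;> simp_all

theorem TV.all_eq_t {ι : Type*} {g : ι → TV} : TV.all g = .t ↔ ∀ i, g i = .t := by
  unfold TV.all
  split_ifs with h h'
  · simp only [false_iff, not_forall]; exact h.imp fun i hi => by simp [hi]
  · simp only [false_iff, not_forall]; exact h'.imp fun i hi => by simp [hi]
  · simp only [true_iff]
    push Not at h h'
    intro i
    cases hi : g i
    · exact (h i hi).elim
    · exact (h' i hi).elim
    · rfl

theorem TV.ex_eq_t {ι : Type*} {g : ι → TV} : TV.ex g = .t ↔ ∃ i, g i = .t := by
  simp [TV.ex, TV.neg_eq_t, TV.all_eq_f, TV.neg_eq_f]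

theorem TV.ex_eq_f {ι : Type*} {g : ι → TV} : TV.ex g = .f ↔ ∀ i, g i = .f := by
  simp [TV.ex, TV.neg_eq_t, TV.all_eq_t, TV.neg_eq_f]

theorem TV.ofProp_eq_t {P : Prop} : TV.ofProp P = .t ↔ P := by
  unfold TV.ofProp; split_ifs <;> simp_all

theorem TV.ofProp_eq_f {P : Prop} : TV.ofProp P = .f ↔ ¬ P := by
  unfold TV.ofProp; split_ifs <;> simp_all

theorem TV.eq_of_iff {a b : TV} (ht : a = .t ↔ b = .t) (hf : a = .f ↔ b = .f) : a = b := by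
  cases a <;> cases b <;> simp_all

/-- A three-valued interpretation amounts to a lower bound (the true atoms) and an upper bound (the
atoms that are not false). The two equivalences are proved together because negation exchanges them.
-/
theorem Fml.value_iff (A : Atom L D → TV) (φ : FOFml L V) : ∀ v : V → D,
    (φ.value A v = .t ↔ φ.PairSat {a | A a = .t} {a | A a ≠ .f} v) ∧
    (φ.value A v = .f ↔ ¬ φ.PairSat {a | A a ≠ .f} {a | A a = .t} v) := by
  induction φ with
  | ext e => exact e.elim
  | _ =>
    intro v
    simp_all [Fml.value, Fml.PairSat, TV.neg_eq_t, TV.neg_eq_f, TV.and_eq_t, TV.and_eq_f,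
      TV.or_eq_t, TV.or_eq_f, TV.all_eq_t, TV.all_eq_f, TV.ex_eq_t, TV.ex_eq_f, TV.ofProp_eq_t,
      TV.ofProp_eq_f]
    try tauto

end Kleene

/-! ### Ground instances of definitions, through which every semantics sees them. -/

section Instances

variable {L : FirstOrder.Language.{u, v}} {V : Type w} {D : Type d} [L.Structure D]

/-- The instances of the rules of a definition: the head atom and the truth of the body. -/
def Definition.instances (Φ : Definition L V) (val : V → D) :
    Set (Atom L D × (Set (Atom L D) → Set (Atom L D) → Prop)) :=
  {i | ∃ r ∈ Φ.rules, ∃ v, r.IsInstance val v ∧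
    i = (r.headAtom v, fun I J => r.body.PairSat I J v)}

/-- Every rule has at least the instance `val`, so no defined predicate is lost in passing to
instances. -/
theorem Definition.defined_eq (Φ : Definition L V) (val : V → D) :
    Φ.defined = {R | ∃ i ∈ Φ.instances val, i.1.1 = R} := by
  ext R
  constructor
  · rintro ⟨r, hr, rfl⟩
    exact ⟨_, ⟨r, hr, val, fun _ _ => rfl, rfl⟩, rfl⟩
  · rintro ⟨_, ⟨r, hr, v, _, rfl⟩, rfl⟩
    exact ⟨r, hr, rfl⟩

theorem Definition.mem_op_iff (Φ : Definition L V) (val : V → D) (p I J : Set (Atom L D))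
    (a : Atom L D) : a ∈ Φ.op p val I J ↔
      (∃ i ∈ Φ.instances val, i.1 = a ∧ i.2 I J) ∨ (a.1 ∉ Φ.defined ∧ a ∈ p) := by
  refine or_congr ⟨?_, ?_⟩ Iff.rfl
  · rintro ⟨_, r, hr, v, hv, rfl, hb⟩
    exact ⟨_, ⟨r, hr, v, hv, rfl⟩, rfl, hb⟩
  · rintro ⟨_, ⟨r, hr, v, hv, rfl⟩, rfl, hb⟩
    exact ⟨⟨r, hr, rfl⟩, r, hr, v, hv, rfl, hb⟩

theorem Definition.bodyValue_eq_t (Φ : Definition L V) (A : Atom L D → TV) (val : V → D)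
    (a : Atom L D) : Φ.bodyValue A val a = .t ↔
      ∃ i ∈ Φ.instances val, i.1 = a ∧ i.2 {b | A b = .t} {b | A b ≠ .f} := by
  rw [Definition.bodyValue, TV.ex_eq_t]
  constructor
  · rintro ⟨⟨⟨r, v⟩, hr, hv⟩, h⟩
    rw [TV.and_eq_t, TV.ofProp_eq_t, (Fml.value_iff A _ _).1] at h
    exact ⟨_, ⟨r, hr, v, hv, rfl⟩, h⟩
  · rintro ⟨_, ⟨r, hr, v, hv, rfl⟩, h⟩
    refine ⟨⟨⟨r, v⟩, hr, hv⟩, ?_⟩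
    rw [TV.and_eq_t, TV.ofProp_eq_t, (Fml.value_iff A _ _).1]
    exact h

theorem Definition.bodyValue_eq_f (Φ : Definition L V) (A : Atom L D → TV) (val : V → D)
    (a : Atom L D) : Φ.bodyValue A val a = .f ↔
      ∀ i ∈ Φ.instances val, i.1 = a → ¬ i.2 {b | A b ≠ .f} {b | A b = .t} := by
  rw [Definition.bodyValue, TV.ex_eq_f]
  constructor
  · rintro h _ ⟨r, hr, v, hv, rfl⟩ ha
    have := h ⟨⟨r, v⟩, hr, hv⟩
    rw [TV.and_eq_f, TV.ofProp_eq_f, (Fml.value_iff A _ _).2] at this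
    exact this.resolve_left (not_not_intro ha)
  · rintro h ⟨⟨r, v⟩, hr, hv⟩
    rw [TV.and_eq_f, TV.ofProp_eq_f, (Fml.value_iff A _ _).2]
    exact or_iff_not_imp_left.2 fun ha => h _ ⟨r, hr, v, hv, rfl⟩ (not_not.1 ha)

theorem Definition.instances_mono (Φ : Definition L V) {val : V → D}
    {i : Atom L D × (Set (Atom L D) → Set (Atom L D) → Prop)} (hi : i ∈ Φ.instances val)
    {p p' q q' : Set (Atom L D)} (hp : p ⊆ p') (hq : q' ⊆ q) (h : i.2 p q) : i.2 p' q' := by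
  obtain ⟨r, _, v, _, rfl⟩ := hi
  exact r.body.pairSat_mono hp hq h

theorem Definition.op_mono (Φ : Definition L V) {p q I J : Set (Atom L D)} {val : V → D}
    (h : I ⊆ J) : Φ.op p val I q ⊆ Φ.op p val J q := by
  intro a
  rw [Φ.mem_op_iff, Φ.mem_op_iff]
  exact Or.imp_left fun ⟨i, hi, ha, hb⟩ => ⟨i, hi, ha, Φ.instances_mono hi h le_rfl hb⟩

theorem Rule.args_congr {r : Rule L V} {v v' : V → D}
    (h : ∀ y ∈ (⋃ i, tvars (r.args i)) ∪ r.body.foFree, v y = v' y) :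
    r.headAtom v = r.headAtom v' ∧
      (fun I J => r.body.PairSat I J v) = fun I J => r.body.PairSat I J v' := by
  constructor
  · have : ∀ i, (r.args i).realize v = (r.args i).realize v' := fun i =>
      realize_congr fun y hy => h y (Or.inl (Set.mem_iUnion.2 ⟨i, hy⟩))
    simp only [Rule.headAtom, this]
  · funext I J
    exact propext (r.body.pairSat_congr fun y hy => h y (Or.inr hy))

theorem Definition.instances_congr (Φ : Definition L V) {v v' : V → D}
    (h : ∀ y ∈ Φ.free, v y = v' y) : Φ.instances v = Φ.instances v' := by
  have key : ∀ v v' : V → D, (∀ y ∈ Φ.free, v y = v' y) → Φ.instances v ⊆ Φ.instances v' := by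
    rintro v v' h _ ⟨r, hr, v₁, hv₁, rfl⟩
    refine ⟨r, hr, fun y => if y ∈ r.bound then v₁ y else v' y, fun y hy => if_neg hy, ?_⟩
    have := Rule.args_congr (r := r) (v := v₁)
      (v' := fun y => if y ∈ r.bound then v₁ y else v' y) fun y hy => by
        by_cases hb : y ∈ r.bound
        · simp [hb]
        · simp only [hb, if_false]
          rw [hv₁ y hb]
          exact h y (Set.mem_biUnion hr ⟨hy, hb⟩)
    rw [this.1, this.2]
  exact (key v v' h).antisymm (key v' v fun y hy => (h y hy).symm)

/-- The instances of a rule and of the result of a substitution in it. -/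
theorem Rule.Subst.instances {σ : V → L.Term V} {r r' : Rule L V} (h : r.Subst σ r') (v : V → D)
    (i : Atom L D × (Set (Atom L D) → Set (Atom L D) → Prop)) :
    (∃ v₁, r'.IsInstance v v₁ ∧ i = (r'.headAtom v₁, fun I J => r'.body.PairSat I J v₁)) ↔
    ∃ v₁, r.IsInstance (fun y => (σ y).realize v) v₁ ∧
      i = (r.headAtom v₁, fun I J => r.body.PairSat I J v₁) := by
  obtain ⟨ρ, b, hinj, hfr, hb, rfl⟩ := h
  set σ' : V → L.Term V := fun y => if y ∈ r.bound then .var (ρ y) else σ y with hσ'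
  have main : ∀ v₁ : V → D, (∀ y, y ∉ r.bound.map ρ → v₁ y = v y) →
      ∀ v₂ : V → D, r.IsInstance (fun y => (σ y).realize v) v₂ →
      (∀ y ∈ r.bound, v₂ y = v₁ (ρ y)) →
      Rule.headAtom ⟨r.bound.map ρ, r.pred, fun i => (r.args i).subst σ', b⟩ v₁ = r.headAtom v₂ ∧
      (fun I J => b.PairSat I J v₁) = fun I J => r.body.PairSat I J v₂ := by
    intro v₁ h₁ v₂ h₂ h₁₂
    have := Rule.args_congr (r := r) (v := fun y => (σ' y).realize v₁) (v' := v₂) fun y hy => by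
      by_cases hyb : y ∈ r.bound
      · simp [hσ', hyb, h₁₂]
      · simp only [hσ', hyb, if_false]
        rw [h₂ y hyb]
        refine realize_congr fun z hz => h₁ z fun hz' => ?_
        obtain ⟨x, hx, rfl⟩ := List.mem_map.1 hz'
        exact hfr x hx y ⟨hy, hyb⟩ hz
    rw [← this.1, ← this.2]
    constructor
    · simp only [Rule.headAtom, Term.realize_subst]
    · funext I J
      exact propext hb.pairSat
  constructor
  · rintro ⟨v₁, h₁, rfl⟩
    let v₂ : V → D := fun y => if y ∈ r.bound then v₁ (ρ y) else (σ y).realize v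
    have hv₂ : r.IsInstance (fun y => (σ y).realize v) v₂ := fun y hy => if_neg hy
    have := main v₁ h₁ v₂ hv₂ fun y hy => if_pos hy
    exact ⟨v₂, hv₂, Prod.ext this.1 this.2⟩
  · rintro ⟨v₂, h₂, rfl⟩
    -- The values of the bound symbols are carried along `ρ`; the choice of a preimage is harmless
    -- because `ρ` is injective on them.
    let v₁ : V → D := fun z => if hz : ∃ x ∈ r.bound, ρ x = z then v₂ hz.choose else v z
    have hv₁ : ∀ y, y ∉ r.bound.map ρ → v₁ y = v y := fun y hy =>
      dif_neg fun ⟨x, hx, hxy⟩ => hy (List.mem_map.2 ⟨x, hx, hxy⟩)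
    have := main v₁ hv₁ v₂ h₂ fun y hy => by
      have hz : ∃ x ∈ r.bound, ρ x = ρ y := ⟨y, hy, rfl⟩
      simp only [v₁, dif_pos hz]
      rw [hinj hz.choose_spec.1 hy hz.choose_spec.2]
    exact ⟨v₁, hv₁, (Prod.ext this.1 this.2).symm⟩

theorem Definition.Subst.instances {σ : V → L.Term V} {Φ Φ' : Definition L V} (h : Φ.Subst σ Φ')
    (v : V → D) : Φ'.instances v = Φ.instances fun y => (σ y).realize v := by
  ext i
  constructor
  · rintro ⟨r', hr', h'⟩
    obtain ⟨r, hr, hs⟩ := h.2 r' hr'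
    exact ⟨r, hr, (hs.instances v i).1 h'⟩
  · rintro ⟨r, hr, h'⟩
    obtain ⟨r', hr', hs⟩ := h.1 r hr
    exact ⟨r', hr', (hs.instances v i).2 h'⟩

end Instances

/-! ### Replacing positive occurrences by formulas. -/

section Replacement

variable {L : FirstOrder.Language.{u, v}} {V : Type w} {D : Type d} [L.Structure D]

theorem realize_tupleSubst {n : ℕ} (z : Fin n → V) (s : Fin n → L.Term V) (v : V → D) :
    (fun y => (tupleSubst z s y).realize v) =
      Function.extend z (fun i => (s i).realize v) v := by
  funext y
  unfold tupleSubst Function.extend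
  split_ifs <;> simp

/-- The value of a formula does not depend on predicates that do not occur in it. -/
theorem Fml.pairSat_congr_occ (φ : FOFml L V) : ∀ {p p' q q' : Set (Atom L D)} {v : V → D},
    (∀ a : Atom L D, a.1 ∈ φ.occ true → (a ∈ p ↔ a ∈ p')) →
    (∀ a : Atom L D, a.1 ∈ φ.occ false → (a ∈ q ↔ a ∈ q')) →
    (φ.PairSat p q v ↔ φ.PairSat p' q' v) := by
  induction φ with
  | top => intros; rfl
  | bot => intros; rfl
  | eq => intros; rfl
  | rel R ts => intro _ _ _ _ _ hp _; exact hp _ ⟨rfl, rfl⟩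
  | ext e => exact e.elim
  | neg φ ih => intro _ _ _ _ _ hp hq; exact not_congr (ih hq hp)
  | and φ ψ ih₁ ih₂ =>
    intro _ _ _ _ _ hp hq
    exact and_congr (ih₁ (fun a h => hp a (Or.inl h)) fun a h => hq a (Or.inl h))
      (ih₂ (fun a h => hp a (Or.inr h)) fun a h => hq a (Or.inr h))
  | or φ ψ ih₁ ih₂ =>
    intro _ _ _ _ _ hp hq
    exact or_congr (ih₁ (fun a h => hp a (Or.inl h)) fun a h => hq a (Or.inl h))
      (ih₂ (fun a h => hp a (Or.inr h)) fun a h => hq a (Or.inr h))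
  | imp φ ψ ih₁ ih₂ =>
    intro _ _ _ _ _ hp hq
    exact imp_congr (ih₁ (fun a h => hq a (Or.inl h)) fun a h => hp a (Or.inl h))
      (ih₂ (fun a h => hp a (Or.inr h)) fun a h => hq a (Or.inr h))
  | iff φ ψ ih₁ ih₂ =>
    intro _ _ _ _ _ hp hq
    exact and_congr
      (imp_congr
        (ih₁ (fun a h => hq a (Or.inl (Or.inr h))) fun a h => hp a (Or.inl (Or.inr h)))
        (ih₂ (fun a h => hp a (Or.inr (Or.inl h))) fun a h => hq a (Or.inr (Or.inl h))))
      (imp_congr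
        (ih₂ (fun a h => hq a (Or.inr (Or.inr h))) fun a h => hp a (Or.inr (Or.inr h)))
        (ih₁ (fun a h => hp a (Or.inl (Or.inl h))) fun a h => hq a (Or.inl (Or.inl h))))
  | all x φ ih => intro _ _ _ _ _ hp hq; exact forall_congr' fun a => ih hp hq
  | ex x φ ih => intro _ _ _ _ _ hp hq; exact exists_congr fun a => ih hp hq

/-- The interpretation that agrees with `p` except that each `R ∈ Pi` is interpreted by `F R`. -/
def interpretBy (Pi : Set (PredSym L)) (F : PredSym L → FOFml L V)
    (z : (R : PredSym L) → Fin R.1 → V) (p : Set (Atom L D)) (val : V → D) : Set (Atom L D) :=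
  {a | if a.1 ∈ Pi then (F a.1).PairSat p p (Function.extend (z a.1) a.2 val) else a ∈ p}

theorem mem_interpretBy_of_notMem {Pi : Set (PredSym L)} {F : PredSym L → FOFml L V}
    {z : (R : PredSym L) → Fin R.1 → V} {p : Set (Atom L D)} {val : V → D} {a : Atom L D}
    (h : a.1 ∉ Pi) : a ∈ interpretBy Pi F z p val ↔ a ∈ p := by
  simp [interpretBy, h]

theorem mem_interpretBy_of_mem {Pi : Set (PredSym L)} {F : PredSym L → FOFml L V}
    {z : (R : PredSym L) → Fin R.1 → V} {p : Set (Atom L D)} {val : V → D} {a : Atom L D}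
    (h : a.1 ∈ Pi) : a ∈ interpretBy Pi F z p val ↔
      (F a.1).PairSat p p (Function.extend (z a.1) a.2 val) := by
  simp [interpretBy, h]

theorem extend_congr_of_notMem_range {n : ℕ} {z : Fin n → V} {s : Fin n → D} {v v' : V → D} {y : V}
    (h : y ∉ Set.range z → v y = v' y) : Function.extend z s v y = Function.extend z s v' y := by
  unfold Function.extend
  split_ifs with hy
  · rfl
  · exact h hy

/-- An occurrence that is positive in the whole formula is negative inside a subformula in negative
position, so `pol` decides which component of the pair receives the replacement. The hypothesis on
`v` fixes the parameters of the relevant `F R` at their values under `val`; quantifiers preserve it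
because their renamed symbol is not such a parameter. -/
theorem ReplPos.pairSat {Pi : Set (PredSym L)} {F : PredSym L → FOFml L V}
    {z : (R : PredSym L) → Fin R.1 → V} {p : Set (Atom L D)} {val : V → D} {pol : Bool}
    {σ : V → L.Term V} {ψ ψ' : FOFml L V} (h : ReplPos Pi F z pol σ ψ ψ') :
    ∀ {v : V → D},
      (∀ R ∈ Pi, R ∈ ψ.occ pol → ∀ y ∈ (F R).foFree, y ∉ Set.range (z R) → v y = val y) →
      (ψ'.PairSat p p v ↔
        ψ.PairSat (bif pol then interpretBy Pi F z p val else p)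
          (bif pol then p else interpretBy Pi F z p val) fun y => (σ y).realize v) := by
  induction h with
  | top => intros; rfl
  | bot => intros; rfl
  | eq => intros; simp only [Fml.PairSat, Term.realize_subst]
  | relKeep pol σ R ts hR =>
    intro v _
    simp only [Fml.PairSat, Term.realize_subst]
    rcases hR with rfl | hR
    · rfl
    · cases pol
      · rfl
      · exact (mem_interpretBy_of_notMem (by exact hR)).symm
  | relRepl σ R ts χ hR hχ =>
    intro v hv
    rw [hχ.pairSat, realize_tupleSubst]
    simp only [Fml.PairSat, cond_true]
    rw [mem_interpretBy_of_mem (by exact hR)]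
    simp only [Term.realize_subst]
    exact (F R).pairSat_congr fun y hy =>
      extend_congr_of_notMem_range (hv R hR ⟨rfl, rfl⟩ y hy)
  | neg pol σ φ φ' _ ih =>
    intro v hv
    have := ih hv
    cases pol <;> exact not_congr this
  | and pol σ φ φ' ψ ψ' _ _ ih₁ ih₂ =>
    intro v hv
    exact and_congr (ih₁ fun R hR ho => hv R hR (Or.inl ho))
      (ih₂ fun R hR ho => hv R hR (Or.inr ho))
  | or pol σ φ φ' ψ ψ' _ _ ih₁ ih₂ =>
    intro v hv
    exact or_congr (ih₁ fun R hR ho => hv R hR (Or.inl ho))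
      (ih₂ fun R hR ho => hv R hR (Or.inr ho))
  | imp pol σ φ φ' ψ ψ' _ _ ih₁ ih₂ =>
    intro v hv
    have h₁ := ih₁ (v := v) fun R hR ho => hv R hR (Or.inl ho)
    have h₂ := ih₂ (v := v) fun R hR ho => hv R hR (Or.inr ho)
    cases pol <;> exact imp_congr h₁ h₂
  | iffKeep pol σ φ φ' ψ ψ' ho _ _ ih₁ ih₂ =>
    intro v _
    -- `occ true` of a biconditional collects occurrences of both polarities of its sides, so here
    -- no predicate of `Pi` occurs at all.
    have occ_sub : ∀ R, R ∈ φ.occ pol ∪ ψ.occ pol → R ∈ (Fml.iff φ ψ).occ true := by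
      rintro R (h | h) <;> cases pol
      · exact .inl (.inr h)
      · exact .inl (.inl h)
      · exact .inr (.inr h)
      · exact .inr (.inl h)
    have h₁ := ih₁ (v := v) fun R hR hR' => (ho R hR (occ_sub R (.inl hR'))).elim
    have h₂ := ih₂ (v := v) fun R hR hR' => (ho R hR (occ_sub R (.inr hR'))).elim
    -- Hence `p` and `interpretBy Pi F z p val` are interchangeable in either component, which
    -- absorbs the swap of the pair inside a biconditional.
    have c : ∀ q q' r r' : Set (Atom L D), (q = p ∨ q = interpretBy Pi F z p val) →
        (q' = p ∨ q' = interpretBy Pi F z p val) → (r = p ∨ r = interpretBy Pi F z p val) →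
        (r' = p ∨ r' = interpretBy Pi F z p val) →
        ((φ.PairSat q q' fun y => (σ y).realize v) ↔ φ.PairSat r r' fun y => (σ y).realize v) ∧
        ((ψ.PairSat q q' fun y => (σ y).realize v) ↔ ψ.PairSat r r' fun y => (σ y).realize v) := by
      have hp : ∀ q : Set (Atom L D), (q = p ∨ q = interpretBy Pi F z p val) → ∀ a : Atom L D,
          a.1 ∉ Pi → (a ∈ q ↔ a ∈ p) := by
        rintro q (rfl | rfl) a ha
        · rfl
        · exact mem_interpretBy_of_notMem ha
      intro q q' r r' hq hq' hr hr'
      constructor <;> refine Fml.pairSat_congr_occ _ (fun a ha => ?_) (fun a ha => ?_)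
      all_goals
        have haPi : a.1 ∉ Pi := fun h => ho a.1 h (by simp [Fml.occ, ha])
        simp only [hp _ hq a haPi, hp _ hq' a haPi, hp _ hr a haPi, hp _ hr' a haPi]
    have e := c p (interpretBy Pi F z p val) (interpretBy Pi F z p val) p (.inl rfl) (.inr rfl)
      (.inr rfl) (.inl rfl)
    cases pol
    all_goals
      simp only [Fml.PairSat, Bool.cond_true, Bool.cond_false] at h₁ h₂ ⊢
      rw [h₁, h₂, e.1, e.2]
  | iffUnwind pol σ φ ψ χ χ' _ _ ih₁ ih₂ =>
    intro v hv
    refine and_congr (ih₁ fun R hR ho => hv R hR ?_) (ih₂ fun R hR ho => hv R hR ?_)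
    · exact ho.elim (fun h => .inl (.inr h)) fun h => .inr (.inl h)
    · exact ho.elim (fun h => .inr (.inr h)) fun h => .inl (.inl h)
  | all pol σ x x' φ φ' hf hx _ ih =>
    intro v hv
    refine forall_congr' fun a => (ih fun R hR ho y hy hy' => ?_).trans
      (φ.pairSat_congr (realize_update_fresh hf v a))
    rw [Function.update_of_ne, hv R hR ho y hy hy']
    rintro rfl
    exact hy' (hx R hR ho hy)
  | ex pol σ x x' φ φ' hf hx _ ih =>
    intro v hv
    refine exists_congr fun a => (ih fun R hR ho y hy hy' => ?_).trans
      (φ.pairSat_congr (realize_update_fresh hf v a))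
    rw [Function.update_of_ne, hv R hR ho y hy hy']
    rintro rfl
    exact hy' (hx R hR ho hy)

end Replacement

/-! ### Soundness relative to an adequate semantics. -/

section Soundness

variable {L : FirstOrder.Language.{u, v}} {V : Type w} {D : Type d} [L.Structure D]

/-- The properties of a semantics `e` of definitions that soundness depends on: definitions with the
same instances are equivalent, a model is a pre-fixed point, and a model is contained in every smaller
pre-fixed point that is definable relative to it. -/
structure AdequateSemantics (p : Set (Atom L D)) (e : Definition L V → (V → D) → Prop) :
    Prop where
  congr : ∀ (Φ Φ' : Definition L V) (v v' : V → D), Φ.instances v = Φ'.instances v' →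
    (e Φ v ↔ e Φ' v')
  prefixed : ∀ (Φ : Definition L V) (v : V → D), e Φ v → Φ.op p v p p ⊆ p
  least : ∀ (Φ : Definition L V) (v : V → D), e Φ v → ∀ (Pi : Set (PredSym L))
    (F : PredSym L → FOFml L V) (z : (R : PredSym L) → Fin R.1 → V), Pi ⊆ Φ.defined →
    Φ.op p v (p ∩ interpretBy Pi F z p v) p ⊆ p ∩ interpretBy Pi F z p v →
    p ⊆ interpretBy Pi F z p v

variable {p : Set (Atom L D)} {e : Definition L V → (V → D) → Prop}

namespace AdequateSemantics

theorem sat_congr (h : AdequateSemantics p e) (φ : IDFml L V) {v v' : V → D}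
    (hv : ∀ y ∈ φ.free, v y = v' y) : φ.Sat p e v ↔ φ.Sat p e v' :=
  φ.sat_congr (fun Φ _ _ hv => h.congr Φ Φ _ _ (Φ.instances_congr hv)) hv

theorem sat_subst (h : AdequateSemantics p e) {σ : V → L.Term V} {φ φ' : IDFml L V}
    (hs : φ.Subst σ φ') (v : V → D) :
    φ'.Sat p e v ↔ φ.Sat p e fun y => (σ y).realize v :=
  hs.sat (fun Φ _ _ hv => h.congr Φ Φ _ _ (Φ.instances_congr hv))
    (fun _ Φ Φ' hs v => h.congr Φ' Φ _ _ (hs.instances v))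

theorem sat_single (h : AdequateSemantics p e) {x : V} {t : L.Term V} {φ φ' : IDFml L V}
    (hs : φ.Subst (singleSubst x t) φ') (v : V → D) :
    φ'.Sat p e v ↔ φ.Sat p e (Function.update v x (t.realize v)) := by
  rw [h.sat_subst hs]
  suffices (fun y => (singleSubst x t y).realize v) = Function.update v x (t.realize v) by
    rw [this]
  funext y
  by_cases hy : y = x
  · subst hy; simp [singleSubst]
  · simp [singleSubst, hy]

theorem sat_update (h : AdequateSemantics p e) {x : V} {φ : IDFml L V} (hx : x ∉ φ.free)
    (v : V → D) (a : D) : φ.Sat p e (Function.update v x a) ↔ φ.Sat p e v :=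
  h.sat_congr φ fun y hy => Function.update_of_ne (by rintro rfl; exact hx hy) _ _

end AdequateSemantics

theorem sequentSat_iff {sat : IDFml L V → Prop} {Γ Δ : Finset (IDFml L V)} :
    SequentSat sat Γ Δ ↔ ((∀ φ ∈ Γ, sat φ) → ∃ φ ∈ Δ, sat φ) := by
  unfold SequentSat
  constructor
  · rintro (h | ⟨φ, hφ, h⟩) hΓ
    · exact h
    · exact (h (hΓ φ hφ)).elim
  · intro h
    by_cases hΓ : ∀ φ ∈ Γ, sat φ
    · exact Or.inl (h hΓ)
    · push Not at hΓ
      exact Or.inr hΓ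

/-- As `σ` moves only the symbols bound by the rule, evaluating it yields an instance of the rule;
its body is true in `p`, and `p` is a pre-fixed point. -/
theorem AdequateSemantics.defR_sound (h : AdequateSemantics p e) {Φ : Definition L V}
    {r : Rule L V} {σ : V → L.Term V} {φ' : FOFml L V} (hr : r ∈ Φ.rules)
    (hσ : ∀ y, y ∉ r.bound → σ y = .var y) (hb : r.body.FOSubst σ φ') {v : V → D}
    (hΦ : e Φ v) (hφ : φ'.toID.Sat p e v) :
    Fml.Sat p e (.rel r.pred fun i => (r.args i).subst σ) v := by
  rw [Fml.sat_toID, hb.pairSat] at hφ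
  simp only [Fml.Sat, Term.realize_subst]
  refine h.prefixed Φ v hΦ (Or.inl ⟨⟨r, hr, rfl⟩, r, hr, fun y => (σ y).realize v, ?_, rfl, hφ⟩)
  intro y hy
  simp [hσ y hy]

/-- Induction over the definition, in the form of leastness. To show that the intersection is
pre-fixed, take a rule instance `v'` that fires in it and apply the minor premise of that rule at
`v'`. The bound symbols are not free in the side formulas, which therefore keep their truth values
from `v`; this leaves `F_Q[s̄]` as the true formula on the right. -/
theorem AdequateSemantics.defL_sound (h : AdequateSemantics p e) {Γ Δ : Finset (IDFml L V)}
    {Φ : Definition L V} {Pi : Set (PredSym L)} {F : PredSym L → FOFml L V}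
    {z : (R : PredSym L) → Fin R.1 → V} {B G : Rule L V → FOFml L V}
    {P : PredSym L} {vs : Fin P.1 → L.Term V} {FP : FOFml L V}
    (hPi : Pi ⊆ Φ.defined) (hP : P ∈ Pi)
    (hfree : ∀ r ∈ Φ.rules, ∀ y ∈ r.bound, ∀ χ ∈ insert (.ext Φ) Γ ∪ Δ, y ∉ χ.free)
    (hF : ∀ r ∈ Φ.rules, r.pred ∈ Pi → ∀ y ∈ r.bound, ∀ R ∈ Pi,
      y ∈ (F R).foFree → y ∈ Set.range (z R))
    (hB : ∀ r ∈ Φ.rules, r.pred ∈ Pi → ReplPos Pi F z true .var r.body (B r))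
    (hG : ∀ r ∈ Φ.rules, r.pred ∈ Pi → (F r.pred).FOSubst (tupleSubst (z r.pred) r.args) (G r))
    (hFP : (F P).FOSubst (tupleSubst (z P) vs) FP)
    (ih : ∀ r ∈ Φ.rules, r.pred ∈ Pi → ∀ v : V → D, SequentSat (fun φ => φ.Sat p e v)
      (insert (B r).toID (insert (.ext Φ) Γ)) (insert (G r).toID Δ))
    {v : V → D} (hΓ : ∀ φ ∈ insert (.ext Φ) Γ, φ.Sat p e v) (hΔ : ∀ φ ∈ Δ, ¬ φ.Sat p e v)
    (hPv : Fml.Sat p e (.rel P vs) v) : FP.toID.Sat p e v := by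
  have hΦ : e Φ v := hΓ _ (Finset.mem_insert_self _ _)
  suffices p ⊆ interpretBy Pi F z p v by
    rw [Fml.sat_toID, hFP.pairSat, realize_tupleSubst]
    exact (mem_interpretBy_of_mem (by exact hP)).1 (this hPv)
  refine h.least Φ v hΦ Pi F z hPi fun a ha => ?_
  -- Membership in `p` also settles every defined predicate outside `Pi`, where `interpretBy` agrees
  -- with `p`.
  have hap : a ∈ p := h.prefixed Φ v hΦ (Φ.op_mono Set.inter_subset_left ha)
  refine ⟨hap, ?_⟩
  by_cases haPi : a.1 ∈ Pi
  swap
  · exact (mem_interpretBy_of_notMem haPi).2 hap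
  obtain ⟨_, r, hr, v', hv', rfl, hb⟩ := ha.resolve_right fun h => h.1 (hPi haPi)
  have hinst : ∀ χ ∈ insert (.ext Φ) Γ ∪ Δ, (χ.Sat p e v' ↔ χ.Sat p e v) := fun χ hχ =>
    h.sat_congr χ fun y hy => hv' y fun hyb => hfree r hr y hyb χ hχ hy
  have hout : ∀ R ∈ Pi, ∀ y ∈ (F R).foFree, y ∉ Set.range (z R) → v' y = v y :=
    fun R hR y hy hyz => hv' y fun hyb => hyz (hF r hr haPi y hyb R hR hy)
  have hBr : (B r).toID.Sat p e v' := by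
    rw [Fml.sat_toID, (hB r hr haPi).pairSat (val := v) fun R hR _ => hout R hR]
    -- The body holds with positive occurrences read in the intersection, hence also when they are
    -- read in the larger `interpretBy`.
    exact r.body.pairSat_mono Set.inter_subset_right le_rfl hb
  have := sequentSat_iff.1 (ih r hr haPi v')
  simp only [Finset.forall_mem_insert, Finset.exists_mem_insert] at this
  rcases this ⟨hBr, (hinst _ (by simp)).2 hΦ, fun φ hφ =>
    (hinst φ (by simp [hφ])).2 (hΓ φ (by simp [hφ]))⟩ with hg | ⟨φ, hφ, hs⟩
  · rw [Fml.sat_toID, (hG r hr haPi).pairSat, realize_tupleSubst] at hg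
    refine (mem_interpretBy_of_mem haPi).2 (((F r.pred).pairSat_congr fun y hy => ?_).1 hg)
    exact extend_congr_of_notMem_range (hout _ haPi y hy)
  · exact (hΔ φ hφ ((hinst φ (by simp [hφ])).1 hs)).elim

/-- The statement ranges over all assignments because substitution, eigenvariables and the rule
instances of (def L) evaluate premises at assignments other than that of the conclusion. -/
theorem Provable.sound {Γ Δ : Finset (IDFml L V)} (hp : Provable Γ Δ)
    (h : AdequateSemantics p e) : ∀ v : V → D, SequentSat (fun φ => φ.Sat p e v) Γ Δ := by
  have subst_left : ∀ {σ : V → L.Term V} {Γ Γ' : Finset (IDFml L V)}, SubstSet σ Γ Γ' →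
      ∀ v : V → D, (∀ φ ∈ Γ', φ.Sat p e v) → ∀ φ ∈ Γ, φ.Sat p e fun y => (σ y).realize v := by
    intro σ Γ Γ' hs v hΓ φ hφ
    obtain ⟨φ', hφ', hφφ'⟩ := hs.1 φ hφ
    exact (h.sat_subst hφφ' v).1 (hΓ φ' hφ')
  have subst_right : ∀ {σ : V → L.Term V} {Δ Δ' : Finset (IDFml L V)}, SubstSet σ Δ Δ' →
      ∀ v : V → D, (∃ φ ∈ Δ, φ.Sat p e fun y => (σ y).realize v) → ∃ φ ∈ Δ', φ.Sat p e v := by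
    rintro σ Δ Δ' hs v ⟨φ, hφ, hsat⟩
    obtain ⟨φ', hφ', hφφ'⟩ := hs.1 φ hφ
    exact ⟨φ', hφ', (h.sat_subst hφφ' v).2 hsat⟩
  simp only [sequentSat_iff]
  induction hp with
  | ax Γ Δ hax =>
    intro v hΓ
    rcases hax with ⟨φ, hφ, hφ'⟩ | hb | ht
    · exact ⟨φ, hφ', hΓ φ hφ⟩
    · exact (hΓ _ hb).elim
    · exact ⟨_, ht, trivial⟩
  | wk Γ Γ' Δ Δ' hΓ hΔ _ ih =>
    intro v hsat
    obtain ⟨φ, hφ, hs⟩ := ih v fun φ hφ => hsat φ (hΓ hφ)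
    exact ⟨φ, hΔ hφ, hs⟩
  | subst Γ Γ' Δ Δ' x t _ hΓ hΔ _ ih =>
    intro v hsat
    exact subst_right hΔ v (ih _ (subst_left hΓ v hsat))
  | allL Γ Δ x t φ φ' hs _ ih =>
    intro v
    have := ih v
    simp only [Finset.forall_mem_insert, Fml.Sat, h.sat_single hs] at this ⊢
    exact fun hΓ => this ⟨hΓ.1 _, hΓ.2⟩
  | exR Γ Δ x t φ φ' hs _ ih =>
    intro v hΓ
    have := ih v hΓ
    simp only [Finset.exists_mem_insert, Fml.Sat, h.sat_single hs] at this ⊢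
    exact this.imp_left fun hφ => ⟨_, hφ⟩
  | allR Γ Δ x φ hx _ ih =>
    intro v hΓ
    simp only [Finset.exists_mem_insert, Fml.Sat] at ih ⊢
    by_contra! hne
    obtain ⟨⟨a, ha⟩, hΔ⟩ := hne
    rcases ih (Function.update v x a) fun χ hχ =>
      (h.sat_update (hx χ (Finset.mem_union_left _ hχ)) v a).2 (hΓ χ hχ) with hφ | ⟨χ, hχ, hs⟩
    · exact ha hφ
    · exact hΔ χ hχ ((h.sat_update (hx χ (Finset.mem_union_right _ hχ)) v a).1 hs)
  | exL Γ Δ x φ hx _ ih =>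
    intro v
    simp only [Finset.forall_mem_insert, Fml.Sat] at ih ⊢
    rintro ⟨⟨a, ha⟩, hΓ⟩
    obtain ⟨χ, hχ, hs⟩ := ih (Function.update v x a) ⟨ha, fun χ hχ =>
      (h.sat_update (hx χ (Finset.mem_union_left _ hχ)) v a).2 (hΓ χ hχ)⟩
    exact ⟨χ, hχ, (h.sat_update (hx χ (Finset.mem_union_right _ hχ)) v a).1 hs⟩
  | eqL Γ Γ₁ Γ₂ Δ Δ₁ Δ₂ x y t s _ hΓ₁ hΔ₁ hΓ₂ hΔ₂ _ ih =>
    intro v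
    simp only [Finset.forall_mem_insert, Fml.Sat]
    rintro ⟨hts, hsat⟩
    -- Where `t` and `s` have equal values, the two substitutions induce the same assignment, so the
    -- premise transfers through the unsubstituted sets `Γ` and `Δ`.
    have heq : (fun u => (doubleSubst x s y t u).realize v) =
        fun u => (doubleSubst x t y s u).realize v := by
      funext u
      simp only [doubleSubst, Function.update_apply]
      split_ifs <;> simp [hts]
    refine subst_right hΔ₂ v ?_
    rw [← heq]
    have hl := subst_left hΓ₂ v hsat
    rw [← heq] at hl
    obtain ⟨φ', hφ', hs'⟩ := ih v fun φ' hφ' => by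
      obtain ⟨φ, hφ, hφφ'⟩ := hΓ₁.2 φ' hφ'
      exact (h.sat_subst hφφ' v).2 (hl φ hφ)
    obtain ⟨φ, hφ, hφφ'⟩ := hΔ₁.2 φ' hφ'
    exact ⟨φ, hφ, (h.sat_subst hφφ' v).1 hs'⟩
  | eqR Γ Δ t => exact fun v _ => ⟨_, Finset.mem_insert_self _ _, rfl⟩
  | defR Γ Δ Φ r σ φ' hr hσ hb _ ih =>
    intro v hΓ
    have := ih v hΓ
    simp only [Finset.exists_mem_insert] at this ⊢
    exact this.imp_left (h.defR_sound hr hσ hb (hΓ _ (Finset.mem_insert_self _ _)))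
  | defL Γ Δ Φ Pi F z B G P vs FP hPi hP _ hfree hF hB hG hFP _ _ ih₁ ih₂ =>
    intro v hΓ
    by_contra! hΔ
    rw [Finset.forall_mem_insert] at hΓ
    have hFPv := h.defL_sound hPi hP hfree hF hB hG hFP
      (fun r hr hrPi v => sequentSat_iff.2 (ih₁ r hr hrPi v)) hΓ.2 hΔ hΓ.1
    obtain ⟨φ, hφ, hs⟩ := ih₂ v (Finset.forall_mem_insert _ _ _ |>.2 ⟨hFPv, hΓ.2⟩)
    exact hΔ φ hφ hs
  | cut Γ Δ φ _ _ ih₁ ih₂ =>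
    intro v
    have h₁ := ih₁ v
    have h₂ := ih₂ v
    simp only [Finset.forall_mem_insert, Finset.exists_mem_insert] at *
    tauto
  | negL Γ Δ φ _ ih | negR Γ Δ φ _ ih | orR Γ Δ φ ψ _ ih | andL Γ Δ φ ψ _ ih
  | impR Γ Δ φ ψ _ ih =>
    intro v
    have h₁ := ih v
    simp only [Finset.forall_mem_insert, Finset.exists_mem_insert, Fml.Sat] at h₁ ⊢
    tauto
  | orL Γ Δ φ ψ _ _ ih₁ ih₂ | andR Γ Δ φ ψ _ _ ih₁ ih₂ | impL Γ Δ φ ψ _ _ ih₁ ih₂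
  | iffL Γ Δ φ ψ _ _ ih₁ ih₂ | iffR Γ Δ φ ψ _ _ ih₁ ih₂ =>
    intro v
    have h₁ := ih₁ v
    have h₂ := ih₂ v
    simp only [Finset.forall_mem_insert, Finset.exists_mem_insert, Fml.Sat] at h₁ h₂ ⊢
    clear ih₁ ih₂
    generalize (∀ φ ∈ Γ, φ.Sat p e v) = A at *
    generalize (∃ φ ∈ Δ, φ.Sat p e v) = B at *
    by_cases φ.Sat p e v <;> by_cases ψ.Sat p e v <;> simp_all

end Soundness

/-! ### Dependence of the semantics on the instances only. -/

section Congruence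

variable {L : FirstOrder.Language.{u, v}} {V : Type w} {D : Type d} [L.Structure D]
  {Φ Φ' : Definition L V} {v v' : V → D}

theorem Definition.defined_congr (h : Φ.instances v = Φ'.instances v') :
    Φ.defined = Φ'.defined := by
  rw [Φ.defined_eq v, Φ'.defined_eq v', h]

theorem Definition.op_congr (h : Φ.instances v = Φ'.instances v') (p I J : Set (Atom L D)) :
    Φ.op p v I J = Φ'.op p v' I J := by
  ext a
  rw [Φ.mem_op_iff, Φ'.mem_op_iff, h, Definition.defined_congr h]

theorem Definition.space_congr (h : Φ.instances v = Φ'.instances v') (p : Set (Atom L D)) :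
    Φ.space p = Φ'.space p := by
  simp only [Definition.space, Definition.defined_congr h]

theorem Definition.isRefinement_congr (h : Φ.instances v = Φ'.instances v') :
    Φ.IsRefinement v = Φ'.IsRefinement v' := by
  have hb : ∀ A : Atom L D → TV, Φ.bodyValue A v = Φ'.bodyValue A v' := fun A => by
    funext a
    apply TV.eq_of_iff
    · rw [Φ.bodyValue_eq_t, Φ'.bodyValue_eq_t, h]
    · rw [Φ.bodyValue_eq_f, Φ'.bodyValue_eq_f, h]
  funext A A'
  simp only [Definition.IsRefinement, hb, Definition.defined_congr h]

theorem Definition.wfModel_congr (h : Φ.instances v = Φ'.instances v') (p : Set (Atom L D)) :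
    Φ.WFModel p v ↔ Φ'.WFModel p v' := by
  have hi : ∀ β A, Φ.IsWFInduction p v β A ↔ Φ'.IsWFInduction p v' β A := fun β A => by
    have hd := Definition.defined_congr h
    have hr := Definition.isRefinement_congr h
    constructor
    · rintro ⟨h₁, h₂, h₃, h₄⟩
      exact ⟨hd ▸ h₁, hd ▸ h₂, hr ▸ h₃, h₄⟩
    · rintro ⟨h₁, h₂, h₃, h₄⟩
      exact ⟨hd ▸ h₁, hd ▸ h₂, hr ▸ h₃, h₄⟩
  simp only [Definition.WFModel, hi, Definition.isRefinement_congr h]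

end Congruence

/-! ### Stable semantics. -/

section Stable

variable {L : FirstOrder.Language.{u, v}} {V : Type w} {D : Type d} [L.Structure D]

theorem inter_interpretBy_mem_space {Φ : Definition L V} {Pi : Set (PredSym L)}
    (hPi : Pi ⊆ Φ.defined) (F : PredSym L → FOFml L V) (z : (R : PredSym L) → Fin R.1 → V)
    (p : Set (Atom L D)) (v : V → D) : p ∩ interpretBy Pi F z p v ∈ Φ.space p := by
  intro a ha
  rw [Set.mem_inter_iff, mem_interpretBy_of_notMem fun h => ha (hPi h), and_self]

/-- The least fixed point of the operator of a definition is its least pre-fixed point. -/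
theorem Definition.StableModel.subset_of_prefixed {Φ : Definition L V} {p q : Set (Atom L D)}
    {v : V → D} (h : Φ.StableModel p v) (hq : Φ.op p v q p ⊆ q) : p ⊆ q := by
  let f : Set (Atom L D) →o Set (Atom L D) := ⟨fun q => Φ.op p v q p, fun _ _ => Φ.op_mono⟩
  have hf : Φ.op p v f.lfp p = f.lfp := f.map_lfp
  refine (h.2 ⟨?_, hf⟩).trans (f.lfp_le hq)
  -- The least fixpoint, taken over all sets of atoms, still lies in the structure space, because
  -- the operator copies `p` on the predicates that are not defined.
  intro a ha
  rw [← hf]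
  exact ⟨fun h => h.elim (fun h => (ha h.1).elim) fun h => h.2, fun h => Or.inr ⟨ha, h⟩⟩

theorem adequateSemantics_stable (p : Set (Atom L D)) :
    AdequateSemantics p fun (Φ : Definition L V) v => Φ.StableModel p v where
  congr _ _ _ _ h := by
    simp only [Definition.StableModel, Definition.op_congr h, Definition.space_congr h]
  prefixed _ _ h := h.1.2.le
  least _ _ h _ _ _ _ hq := (h.subset_of_prefixed hq).trans Set.inter_subset_right

end Stable

/-! ### Well-founded semantics. -/

section WellFounded

variable {L : FirstOrder.Language.{u, v}} {V : Type w} {D : Type d} [L.Structure D]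

theorem TV.PrecLE.refl (a : TV) : a.PrecLE a := Or.inr rfl

theorem TV.PrecLE.trans {a b c : TV} (h : a.PrecLE b) (h' : b.PrecLE c) : a.PrecLE c := by
  rcases h with h | rfl
  · exact Or.inl h
  · exact h'

theorem Definition.IsRefinement.precLE {Φ : Definition L V} {v : V → D} {A A' : Atom L D → TV}
    (h : Φ.IsRefinement v A A') (a : Atom L D) : (A a).PrecLE (A' a) := by
  obtain ⟨U, _, hU, ⟨rfl, _⟩ | ⟨rfl, _⟩⟩ := h
  all_goals
    by_cases ha : a ∈ U
    · exact Or.inl (hU a ha).2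
    · exact Or.inr (by simp [setOn, ha])

namespace Definition.IsWFInduction

variable {Φ : Definition L V} {p : Set (Atom L D)} {v : V → D} {β : Ordinal.{max v d}}
  {A : Ordinal.{max v d} → Atom L D → TV}

theorem precLE (h : Φ.IsWFInduction p v β A) {i j : Ordinal.{max v d}} (hij : i ≤ j)
    (hj : j ≤ β) (a : Atom L D) : (A i a).PrecLE (A j a) := by
  induction j using Ordinal.limitRecOn with
  | zero =>
    obtain rfl : i = 0 := le_antisymm hij zero_le
    exact TV.PrecLE.refl _
  | add_one j ih =>
    rw [← Order.succ_eq_add_one] at hij hj ⊢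
    rcases hij.eq_or_lt with rfl | hlt
    · exact TV.PrecLE.refl _
    · have hjβ : j < β := Order.succ_le_iff.1 hj
      exact (ih (Order.lt_succ_iff.1 hlt) hjβ.le).trans ((h.succ j hjβ).precLE a)
  | limit l hl _ =>
    rcases hij.eq_or_lt with rfl | hlt
    · exact TV.PrecLE.refl _
    · exact (h.limit l hj hl).1 i hlt a

/-- Otherwise `a` is unknown at all earlier stages, and resetting it to `u` at the limit would still
give an upper bound, contrary to leastness. -/
theorem exists_lt_of_limit (h : Φ.IsWFInduction p v β A) {l : Ordinal.{max v d}} (hl : l ≤ β)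
    (hlim : Order.IsSuccLimit l) {a : Atom L D} (ha : A l a ≠ .u) : ∃ i < l, A i a = A l a := by
  by_contra! hne
  obtain ⟨hub, hlub⟩ := h.limit l hl hlim
  refine ha ((hlub (setOn (A l) {a} .u) (fun i hi b => ?_) a).elim id fun h => ?_)
  · by_cases hb : b = a
    · subst hb
      exact Or.inl ((hub i hi b).resolve_right (hne i hi))
    · simpa [setOn, hb] using hub i hi b
  · simpa [setOn] using h

/-- Induction principle: a property of values other than `u` that is preserved by refinements holds
throughout a well-founded induction. -/
theorem value_induction (h : Φ.IsWFInduction p v β A) {C : Atom L D → TV → Prop}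
    (hbase : ∀ a, a.1 ∉ Φ.defined → C a (TV.ofProp (a ∈ p)))
    (hstep : ∀ i < β, (∀ a, A i a ≠ .u → C a (A i a)) → ∀ a, a.1 ∈ Φ.defined → A i a = .u →
      A (Order.succ i) a ≠ .u → C a (A (Order.succ i) a))
    {i : Ordinal.{max v d}} (hi : i ≤ β) : ∀ a, A i a ≠ .u → C a (A i a) := by
  induction i using Ordinal.limitRecOn with
  | zero =>
    intro a ha
    by_cases hd : a.1 ∈ Φ.defined
    · exact (ha (h.zero a hd)).elim
    · rw [h.extends_context 0 hi a hd]
      exact hbase a hd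
  | add_one i ih =>
    rw [← Order.succ_eq_add_one] at hi ⊢
    intro a ha
    have hiβ : i < β := Order.succ_le_iff.1 hi
    rcases (h.succ i hiβ).precLE a with hu | he
    · by_cases hd : a.1 ∈ Φ.defined
      · exact hstep i hiβ (ih hiβ.le) a hd hu ha
      · rw [h.extends_context _ hi a hd]
        exact hbase a hd
    · rw [← he] at ha ⊢
      exact ih hiβ.le a ha
  | limit l hl ih =>
    intro a ha
    obtain ⟨i, hil, he⟩ := h.exists_lt_of_limit hi hl ha
    rw [← he] at ha ⊢
    exact ih i hil (hil.le.trans hi) a ha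

end Definition.IsWFInduction

/-- The invariant is that atoms true at a stage lie in `q`. When an atom is made true, its body
holds with positive occurrences among the true atoms, hence in `q`, and negative ones among the
atoms not false, a superset of `p`; monotonicity then lets the rule fire in `q`. -/
theorem Definition.WFModel.subset_of_prefixed {Φ : Definition L V} {p q : Set (Atom L D)}
    {v : V → D} (h : Φ.WFModel p v) (hs : q ∈ Φ.space p) (hq : Φ.op p v q p ⊆ q) : p ⊆ q := by
  obtain ⟨β, A, hA, _, hβ⟩ := h
  have key := hA.value_induction (C := fun a b => b = .t → a ∈ q)
    (fun a ha hp => (hs a ha).2 (TV.ofProp_eq_t.1 hp)) (fun i hi ih a hd hu hne ht => ?_) le_rfl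
  · intro a ha
    have ht : A β a = .t := by rw [hβ a]; exact TV.ofProp_eq_t.2 ha
    exact key a (by simp [ht]) ht
  · obtain ⟨U, _, hU, ⟨he, hb⟩ | ⟨he, _⟩⟩ := hA.succ i hi
    all_goals
      have haU : a ∈ U := by
        by_contra haU
        rw [he] at hne
        simp [setOn, haU, hu] at hne
    · obtain ⟨j, hj, hja, hsat⟩ := (Φ.bodyValue_eq_t _ _ _).1 (hb a haU)
      refine hq ((Φ.mem_op_iff _ _ _ _ _).2 (Or.inl ⟨j, hj, hja, Φ.instances_mono hj ?_ ?_ hsat⟩))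
      · intro b (hbt : A i b = .t)
        exact ih b (by simp [hbt]) hbt
      -- An atom false at stage `i` remains false up to `β`, so it cannot belong to `p`.
      · intro b hbp (hbf : A i b = .f)
        rcases hA.precLE hi.le le_rfl b with h' | h'
        · simp [hbf] at h'
        · rw [hbf, hβ b] at h'
          exact TV.ofProp_eq_f.1 h'.symm hbp
    · rw [he] at ht
      simp [setOn, haU] at ht

/-- Contrapositive: a defined atom outside `p` was made false at some stage, where its body was
already false. Later stages only gain precision, so the body stays false in the two-valued limit
`p`. -/
theorem Definition.WFModel.prefixed {Φ : Definition L V} {p : Set (Atom L D)}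
    {v : V → D} (h : Φ.WFModel p v) : Φ.op p v p p ⊆ p := by
  obtain ⟨β, A, hA, _, hβ⟩ := h
  have final : ∀ i ≤ β, ∀ a, (A i a = .t → a ∈ p) ∧ (A i a = .f → a ∉ p) := by
    intro i hi a
    rcases hA.precLE hi le_rfl a with h' | h'
    · simp [h']
    · rw [h', hβ a, TV.ofProp_eq_t, TV.ofProp_eq_f]
      exact ⟨id, id⟩
  have key := hA.value_induction (C := fun a b => b = .f → a ∉ Φ.op p v p p)
    (fun a ha hp => ?_) (fun i hi _ a hd hu hne hf => ?_) le_rfl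
  · intro a ha
    by_contra hap
    have hf : A β a = .f := by rw [hβ a]; exact TV.ofProp_eq_f.2 hap
    exact key a (by simp [hf]) hf ha
  · rintro (h' | h')
    · exact ha h'.1
    · exact TV.ofProp_eq_f.1 hp h'.2
  · obtain ⟨U, _, hU, ⟨he, _⟩ | ⟨he, hb⟩⟩ := hA.succ i hi
    all_goals
      have haU : a ∈ U := by
        by_contra haU
        rw [he] at hne
        simp [setOn, haU, hu] at hne
    · rw [he] at hf
      simp [setOn, haU] at hf
    · rw [Φ.mem_op_iff]
      rintro (⟨j, hj, hja, hsat⟩ | h')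
      -- Unfounded sets are tested in the refined structure, so the comparison with `p` is made at
      -- stage `succ i`, not `i`.
      · refine (Φ.bodyValue_eq_f _ _ _).1 (hb a haU) j hj hja (Φ.instances_mono hj ?_ ?_ hsat)
        · intro b hbp hbf
          exact (final _ (Order.succ_le_of_lt hi) b).2 hbf hbp
        · intro b hbt
          exact (final _ (Order.succ_le_of_lt hi) b).1 hbt
      · exact h'.1 hd

theorem adequateSemantics_wellFounded (p : Set (Atom L D)) :
    AdequateSemantics p fun (Φ : Definition L V) v => Φ.WFModel p v where
  congr _ _ _ _ h := Definition.wfModel_congr h p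
  prefixed _ _ h := h.prefixed
  least _ v h _ F z hPi hq :=
    (h.subset_of_prefixed (inter_interpretBy_mem_space hPi F z p v) hq).trans
      Set.inter_subset_right

end WellFounded

/-! ### Definable relations in Henkin classes, and Henkin semantics over the full vocabulary. -/

section Definability

variable {L : FirstOrder.Language.{u, v}} {V : Type w} {D : Type d} [L.Structure D]

/-- The vocabulary of all symbols. -/
def Voc.full (L : FirstOrder.Language.{u, v}) : Voc L := ⟨Set.univ, Set.univ⟩

theorem termOver_full (t : L.Term V) : TermOver (Voc.full L) t := by
  induction t with
  | var => trivial
  | func f ts ih => exact ⟨trivial, ih⟩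

theorem exists_injective_avoiding [Infinite V] {T : Set V} (hT : T.Finite) (n : ℕ) :
    ∃ x : Fin n → V, Function.Injective x ∧ ∀ i, x i ∉ T := by
  have f := hT.infinite_compl.natEmbedding
  exact ⟨fun i => f i, fun i j h => Fin.ext (f.injective (Subtype.ext h)), fun i => (f i).2⟩

namespace IsHenkinClass

variable {p : Set (Atom L D)} {H : (k : ℕ) → Set (Set (Fin k → D))}

theorem union_mem (hH : IsHenkinClass V (Voc.full L) p H) {n : ℕ} {R R' : Set (Fin n → D)}
    (h : R ∈ H n) (h' : R' ∈ H n) : R ∪ R' ∈ H n := by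
  have := hH.compl n _ (hH.inter n _ (hH.compl n _ h) _ (hH.compl n _ h'))
  rwa [Set.compl_inter, compl_compl, compl_compl] at this

variable [Infinite V] [Nonempty D]

/-- Here `w` makes each object symbol a coordinate or a parameter, and several symbols may share a
coordinate. The axiom `terms` wants distinct symbols, so coordinates are first renamed to fresh ones
that cannot clash with the parameters. -/
theorem mem_of_terms (hH : IsHenkinClass V (Voc.full L) p H) {k n : ℕ} {R : Set (Fin k → D)}
    (hR : R ∈ H k) (t : Fin k → L.Term V) (w : V → Fin n ⊕ D) :
    {a : Fin n → D | (fun i => (t i).realize fun y => (w y).elim a id) ∈ R} ∈ H n := by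
  obtain ⟨x, hx, hxT⟩ := exists_injective_avoiding
    (Set.finite_iUnion fun i => finite_tvars (t i)) n
  obtain ⟨d₀⟩ := ‹Nonempty D›
  -- The default `d₀` is never read: symbols sent to a coordinate have been substituted away.
  have := hH.terms k n R hR
    (fun i => (t i).subst fun y => (w y).elim (fun j => .var (x j)) fun _ => .var y)
    (fun _ => termOver_full _) x hx fun y => (w y).elim (fun _ => d₀) id
  convert this using 5 with a i
  rw [Term.realize_subst]
  refine realize_congr fun y hy => ?_
  rcases hw : w y with j | b
  · simp [hx.extend_apply]
  · have : ¬ ∃ j, x j = y := by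
      rintro ⟨j, rfl⟩
      exact hxT j (Set.mem_iUnion.2 ⟨i, hy⟩)
    simp [Function.extend_apply' _ _ _ this, hw]

/-- Equality pulled back along two identical terms holds everywhere. -/
theorem univ_mem (hH : IsHenkinClass V (Voc.full L) p H) (n : ℕ) : Set.univ ∈ H n := by
  obtain ⟨y⟩ := (inferInstance : Nonempty V)
  obtain ⟨d₀⟩ := ‹Nonempty D›
  have := hH.mem_of_terms (n := n) hH.equality (fun _ => .var y) fun _ => Sum.inr d₀
  convert this using 1
  ext a
  simp

/-- Relations definable with parameters by FO-formulas belong to every Henkin class. -/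
theorem definable_mem (hH : IsHenkinClass V (Voc.full L) p H) (φ : FOFml L V) :
    ∀ (n : ℕ) (w : V → Fin n ⊕ D),
      {a : Fin n → D | φ.PairSat p p fun y => (w y).elim a id} ∈ H n := by
  have empty_mem : ∀ n, (∅ : Set (Fin n → D)) ∈ H n := fun n => by
    simpa using hH.compl n _ (hH.univ_mem n)
  have forall_mem : ∀ (ψ : FOFml L V) (x : V), (∀ (n : ℕ) (w : V → Fin n ⊕ D),
      {a : Fin n → D | ψ.PairSat p p fun y => (w y).elim a id} ∈ H n) →
      ∀ (n : ℕ) (w : V → Fin n ⊕ D), {a : Fin n → D | ∀ b : D,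
        ψ.PairSat p p (Function.update (fun y => (w y).elim a id) x b)} ∈ H n := by
    intro ψ x ih n w
    -- The quantified symbol becomes the new last coordinate, overriding its former role in `w`; the
    -- old coordinates keep their indices.
    have := hH.forall_last n _ (ih (n + 1) fun y =>
      if y = x then Sum.inl (Fin.last n) else (w y).map Fin.castSucc id)
    refine (Set.ext fun a => forall_congr' fun b => iff_of_eq (congrArg (ψ.PairSat p p) ?_) :
      _ = _) ▸ this
    funext y
    by_cases hy : y = x
    · subst hy; simp
    · simp only [ne_eq, hy, not_false_eq_true, Function.update_of_ne, if_false]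
      rcases w y with i | d <;> simp
  induction φ with
  | top => intro n w; exact hH.univ_mem n
  | bot => intro n w; exact empty_mem n
  | eq t s => intro n w; exact hH.mem_of_terms hH.equality ![t, s] w
  | rel R ts => intro n w; exact hH.mem_of_terms (hH.predicate R trivial) ts w
  | ext e => exact e.elim
  | neg φ ih => intro n w; exact hH.compl n _ (ih n w)
  | and φ ψ ih₁ ih₂ => intro n w; exact hH.inter n _ (ih₁ n w) _ (ih₂ n w)
  | or φ ψ ih₁ ih₂ => intro n w; exact hH.union_mem (ih₁ n w) (ih₂ n w)
  | imp φ ψ ih₁ ih₂ =>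
    intro n w
    convert hH.union_mem (hH.compl n _ (ih₁ n w)) (ih₂ n w) using 1
    ext a
    exact imp_iff_not_or
  | iff φ ψ ih₁ ih₂ =>
    intro n w
    convert hH.inter n _ (hH.union_mem (hH.compl n _ (ih₁ n w)) (ih₂ n w)) _
      (hH.union_mem (hH.compl n _ (ih₂ n w)) (ih₁ n w)) using 1
    ext a
    exact and_congr imp_iff_not_or imp_iff_not_or
  | all x φ ih => exact forall_mem φ x ih
  | ex x φ ih =>
    intro n w
    convert hH.compl n _ (forall_mem (.neg φ) x (fun n w => hH.compl n _ (ih n w)) n w) using 1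
    ext a
    simp [Fml.PairSat]

theorem adequateSemantics (hH : IsHenkinClass V (Voc.full L) p H) :
    AdequateSemantics p fun (Φ : Definition L V) v => Φ.HenkinModel H p v where
  congr _ _ _ _ h := by
    simp only [Definition.HenkinModel, Definition.op_congr h, Definition.space_congr h,
      Definition.IsPoint, Definition.defined_congr h]
  prefixed _ _ h := h.1.2.2
  least Φ v h Pi F z hPi hq := by
    refine (h.2 ⟨inter_interpretBy_mem_space hPi F z p v, fun P _ => ?_, hq⟩).trans
      Set.inter_subset_right
    have hp : {a : Fin P.1 → D | (⟨P, a⟩ : Atom L D) ∈ p} ∈ H P.1 := hH.predicate P trivial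
    by_cases hP : P ∈ Pi
    -- The symbols `z P` serve as coordinates and all others as parameters with their values under
    -- `v`, which makes the relation given by `F P` definable.
    · convert hH.inter _ _ hp _ (hH.definable_mem (F P) P.1 fun y =>
        if hy : ∃ i, z P i = y then Sum.inl hy.choose else Sum.inr (v y)) using 1
      ext a
      simp only [Set.mem_ofPred_eq, Set.mem_inter_iff]
      rw [mem_interpretBy_of_mem (by exact hP)]
      have : Function.extend (z P) a v = fun y => Sum.elim a id
          (if hy : ∃ i, z P i = y then Sum.inl hy.choose else Sum.inr (v y)) := by
        funext y
        unfold Function.extend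
        split_ifs <;> rfl
      rw [this]
    · convert hp using 1
      ext a
      simp only [Set.mem_ofPred_eq, Set.mem_inter_iff]
      rw [mem_interpretBy_of_notMem (by exact hP), and_self]

end IsHenkinClass

end Definability

/-! ### Trivial reinterpretation of the symbols outside the vocabulary. -/

section Reinterpretation

variable {L : FirstOrder.Language.{u, v}} {V : Type w} {D : Type d}

/-- Two structures with the same domain agree on the vocabulary `S`. -/
structure AgreeOn (S : Voc L) (s s' : L.Structure D) (p p' : Set (Atom L D)) : Prop where
  funMap : ∀ (n : ℕ) (f : L.Functions n), (⟨n, f⟩ : FuncSym L) ∈ S.funcs → s.funMap f = s'.funMap f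
  atoms : ∀ a : Atom L D, a.1 ∈ S.preds → (a ∈ p ↔ a ∈ p')

namespace AgreeOn

variable {S : Voc L} {s s' : L.Structure D} {p p' : Set (Atom L D)}

theorem symm (h : AgreeOn S s s' p p') : AgreeOn S s' s p' p :=
  ⟨fun n f hf => (h.funMap n f hf).symm, fun a ha => (h.atoms a ha).symm⟩

theorem realize_eq (h : AgreeOn S s s' p p') {t : L.Term V} (ht : TermOver S t) (v : V → D) :
    @Term.realize L D s V v t = @Term.realize L D s' V v t := by
  induction t with
  | var => rfl
  | func f ts ih =>
    simp only [Term.realize]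
    rw [h.funMap _ f ht.1]
    congr 1
    funext i
    exact ih i (ht.2 i)

theorem pairSat_iff (h : AgreeOn S s s' p p') (φ : FOFml L V) :
    φ.OverWith S (fun e => e.elim) → ∀ {I I' J J' : Set (Atom L D)} {v : V → D},
    (∀ a : Atom L D, a.1 ∈ S.preds → (a ∈ I ↔ a ∈ I')) →
    (∀ a : Atom L D, a.1 ∈ S.preds → (a ∈ J ↔ a ∈ J')) →
    (@Fml.PairSat L V D s I J φ v ↔ @Fml.PairSat L V D s' I' J' φ v) := by
  induction φ with
  | top => intros; rfl
  | bot => intros; rfl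
  | eq t r =>
    intro ho _ _ _ _ v _ _
    simp only [Fml.PairSat]
    rw [h.realize_eq ho.1, h.realize_eq ho.2]
  | rel R ts =>
    intro ho _ _ _ _ v hI _
    simp only [Fml.PairSat, h.realize_eq (ho.2 _)]
    exact hI _ ho.1
  | ext e => exact e.elim
  | neg φ ih => intro ho _ _ _ _ _ hI hJ; exact not_congr (ih ho hJ hI)
  | and φ ψ ih₁ ih₂ =>
    intro ho _ _ _ _ _ hI hJ; exact and_congr (ih₁ ho.1 hI hJ) (ih₂ ho.2 hI hJ)
  | or φ ψ ih₁ ih₂ =>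
    intro ho _ _ _ _ _ hI hJ; exact or_congr (ih₁ ho.1 hI hJ) (ih₂ ho.2 hI hJ)
  | imp φ ψ ih₁ ih₂ =>
    intro ho _ _ _ _ _ hI hJ; exact imp_congr (ih₁ ho.1 hJ hI) (ih₂ ho.2 hI hJ)
  | iff φ ψ ih₁ ih₂ =>
    intro ho _ _ _ _ _ hI hJ
    exact and_congr (imp_congr (ih₁ ho.1 hJ hI) (ih₂ ho.2 hI hJ))
      (imp_congr (ih₂ ho.2 hJ hI) (ih₁ ho.1 hI hJ))
  | all x φ ih => intro ho _ _ _ _ _ hI hJ; exact forall_congr' fun a => ih ho hI hJ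
  | ex x φ ih => intro ho _ _ _ _ _ hI hJ; exact exists_congr fun a => ih ho hI hJ

theorem mem_op (h : AgreeOn S s s' p p') {Φ : Definition L V} (hΦ : Φ.Over S)
    {I I' : Set (Atom L D)} {v : V → D}
    (hI : ∀ a : Atom L D, a.1 ∈ S.preds → (a ∈ I ↔ a ∈ I')) {a : Atom L D}
    (ha : a.1 ∈ Φ.defined) (hm : a ∈ @Definition.op L V D s' Φ p' v I' p') :
    a ∈ @Definition.op L V D s Φ p v I p := by
  rcases hm with ⟨hd, r, hr, v', hv', rfl, hb⟩ | hm
  · refine Or.inl ⟨hd, r, hr, v', hv', ?_, ?_⟩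
    · simp only [Rule.headAtom, h.realize_eq ((hΦ r hr).2.1 _)]
    · exact (h.pairSat_iff r.body (hΦ r hr).2.2 hI h.atoms).2 hb
  · exact (hm.1 ha).elim

/-- Only one direction is needed, since `AgreeOn` is symmetric. The structures may differ on
undefined predicates outside `S`, so competitors for leastness have to be moved between two
structure spaces. -/
theorem henkinModel (h : AgreeOn S s s' p p') {H : (k : ℕ) → Set (Set (Fin k → D))}
    {Φ : Definition L V} (hΦ : Φ.Over S) {v : V → D}
    (hm : @Definition.HenkinModel L V D s H Φ p v) :
    @Definition.HenkinModel L V D s' H Φ p' v := by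
  have hdef : ∀ P ∈ Φ.defined, P ∈ S.preds := by
    rintro _ ⟨r, hr, rfl⟩
    exact (hΦ r hr).1
  obtain ⟨⟨-, hpt, hpre⟩, hleast⟩ := hm
  refine ⟨⟨fun _ _ => Iff.rfl, fun P hP => ?_, fun a ha => ?_⟩, ?_⟩
  · convert hpt P hP using 1
    ext a
    exact (h.atoms ⟨P, a⟩ (hdef P hP)).symm
  · by_cases hd : a.1 ∈ Φ.defined
    · exact (h.atoms a (hdef _ hd)).1 (hpre (h.mem_op hΦ h.atoms hd ha))
    · exact (ha.resolve_left fun h => hd h.1).2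
  · rintro q ⟨hq, hqpt, hqpre⟩
    -- The competitor `q` is transplanted to the space of `p`: it is kept on the defined predicates
    -- and replaced by `p` elsewhere. On `S` nothing changes, so it remains pre-fixed.
    let q' : Set (Atom L D) := {a | if a.1 ∈ Φ.defined then a ∈ q else a ∈ p}
    have hdq : ∀ a : Atom L D, a.1 ∈ Φ.defined → (a ∈ q' ↔ a ∈ q) := fun a ha => by
      simp [q', ha]
    have hndq : ∀ a : Atom L D, a.1 ∉ Φ.defined → (a ∈ q' ↔ a ∈ p) := fun a ha => by
      simp [q', ha]
    have hqq : ∀ a : Atom L D, a.1 ∈ S.preds → (a ∈ q ↔ a ∈ q') := fun a ha => by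
      by_cases hd : a.1 ∈ Φ.defined
      · exact (hdq a hd).symm
      · rw [hndq a hd, hq a hd, h.atoms a ha]
    have hpq : p ⊆ q' := hleast ⟨hndq, fun P hP => by
        convert hqpt P hP using 1
        ext a
        exact hdq ⟨P, a⟩ hP, fun a ha => by
        by_cases hd : a.1 ∈ Φ.defined
        · exact (hdq a hd).2 (hqpre (h.symm.mem_op hΦ hqq hd ha))
        · exact (hndq a hd).2 (ha.resolve_left fun h => hd h.1).2⟩
    intro a ha
    by_cases hd : a.1 ∈ Φ.defined
    · exact (hdq a hd).1 (hpq ((h.atoms a (hdef _ hd)).2 ha))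
    · exact (hq a hd).2 ha

theorem sat_iff (h : AgreeOn S s s' p p') {e e' : Definition L V → (V → D) → Prop}
    (he : ∀ Φ : Definition L V, Φ.Over S → ∀ v, e Φ v ↔ e' Φ v) (φ : IDFml L V) :
    φ.Over S → ∀ {v : V → D}, @Fml.Sat L V D s p e φ v ↔ @Fml.Sat L V D s' p' e' φ v := by
  induction φ with
  | top => intros; rfl
  | bot => intros; rfl
  | eq t r =>
    intro ho v
    simp only [Fml.Sat]
    rw [h.realize_eq ho.1, h.realize_eq ho.2]
  | rel R ts =>
    intro ho v
    simp only [Fml.Sat, h.realize_eq (ho.2 _)]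
    exact h.atoms _ ho.1
  | ext Φ => intro ho v; exact he Φ ho v
  | neg φ ih => intro ho v; exact not_congr (ih ho)
  | and φ ψ ih₁ ih₂ => intro ho v; exact and_congr (ih₁ ho.1) (ih₂ ho.2)
  | or φ ψ ih₁ ih₂ => intro ho v; exact or_congr (ih₁ ho.1) (ih₂ ho.2)
  | imp φ ψ ih₁ ih₂ => intro ho v; exact imp_congr (ih₁ ho.1) (ih₂ ho.2)
  | iff φ ψ ih₁ ih₂ => intro ho v; exact iff_congr (ih₁ ho.1) (ih₂ ho.2)
  | all x φ ih => intro ho v; exact forall_congr' fun a => ih ho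
  | ex x φ ih => intro ho v; exact exists_congr fun a => ih ho

end AgreeOn

variable [s : L.Structure D]

/-- The structure that agrees with `s` on `S` and interprets all other predicate symbols as empty and
all other function symbols as constant. -/
@[reducible] def reinterpret (s : L.Structure D) (S : Voc L) (d₀ : D) : L.Structure D where
  funMap {n} f xs := if (⟨n, f⟩ : FuncSym L) ∈ S.funcs then s.funMap f xs else d₀
  RelMap {n} R xs := (⟨n, R⟩ : PredSym L) ∈ S.preds ∧ s.RelMap R xs

theorem agreeOn_reinterpret (S : Voc L) (d₀ : D) : AgreeOn S s (reinterpret s S d₀)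
    (@trueAtoms L D s) (@trueAtoms L D (reinterpret s S d₀)) where
  funMap n f hf := by
    funext xs
    exact (if_pos hf).symm
  atoms a ha := ⟨fun h => ⟨ha, h⟩, fun h => h.2⟩

/-- Replaces the subterms that do not start with a symbol of `S` by the object symbol `c`. -/
def truncate (S : Voc L) (c : V) : L.Term V → L.Term V
  | .var y => .var y
  | @Term.func _ _ n f ts =>
    if (⟨n, f⟩ : FuncSym L) ∈ S.funcs then .func f fun i => truncate S c (ts i) else .var c

theorem termOver_truncate (S : Voc L) (c : V) (t : L.Term V) : TermOver S (truncate S c t) := by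
  induction t with
  | var => trivial
  | func f ts ih =>
    rw [truncate]
    split_ifs with hf
    · exact ⟨hf, ih⟩
    · trivial

theorem realize_truncate (S : Voc L) {c : V} {d₀ : D} {t : L.Term V} {v v' : V → D}
    (hv : ∀ y ∈ tvars t, v y = v' y) (hc : v c = d₀) :
    (truncate S c t).realize v = @Term.realize L D (reinterpret s S d₀) V v' t := by
  induction t with
  | var y => exact hv y (by simp [tvars_var])
  | func f ts ih =>
    rw [truncate]
    have ih' := fun i => ih i fun y hy =>
      hv y (by rw [tvars_func]; exact Set.mem_iUnion.2 ⟨i, hy⟩)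
    split_ifs with hf
    · simp only [Term.realize, ih']
      exact (if_pos hf).symm
    · exact hc.trans (if_neg hf).symm

/-- A term over all symbols takes, in the new structure, the value of its truncation over `S` once
the symbol `c` denotes `d₀`. The predicates outside `S` are empty, and the empty relation is already
in `H`. -/
theorem IsHenkinClass.reinterpret [Infinite V] {S : Voc L} (d₀ : D)
    {H : (k : ℕ) → Set (Set (Fin k → D))} (hH : IsHenkinClass V S (trueAtoms L D) H) :
    @IsHenkinClass L D (reinterpret s S d₀) V (Voc.full L)
      (@trueAtoms L D (FOID.reinterpret s S d₀)) H := by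
  have terms : ∀ k n, ∀ R ∈ H k, ∀ t : Fin k → L.Term V, ∀ x : Fin n → V, Function.Injective x →
      ∀ val : V → D, {a : Fin n → D | (fun i => @Term.realize L D (FOID.reinterpret s S d₀) V
        (Function.extend x a val) (t i)) ∈ R} ∈ H n := by
    intro k n R hR t x hx val
    -- `c` avoids the terms, so that setting its value to `d₀` does not disturb them, and the
    -- coordinates `x`, so that this value is not overwritten.
    obtain ⟨c, hc⟩ := ((Set.finite_iUnion fun i => finite_tvars (t i)).union
      (Set.finite_range x)).infinite_compl.nonempty
    have := hH.terms k n R hR (fun i => truncate S c (t i)) (fun i => termOver_truncate S c _)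
      x hx (Function.update val c d₀)
    convert this using 5 with a i
    refine (realize_truncate S (fun y hy => ?_) ?_).symm
    · refine extend_congr_of_notMem_range fun _ => Function.update_of_ne ?_ _ _
      rintro rfl
      exact hc (Or.inl (Set.mem_iUnion.2 ⟨i, hy⟩))
    · rw [Function.extend_apply' _ _ _ fun h => hc (Or.inr h), Function.update_self]
  refine @IsHenkinClass.mk L D (FOID.reinterpret s S d₀) V _ _ _ hH.equality (fun Q _ => ?_)
    hH.section_last (fun k n R hR t _ x hx val => terms k n R hR t x hx val) hH.compl hH.inter
    hH.forall_last
  by_cases hQ : Q ∈ S.preds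
  · convert hH.predicate Q hQ using 1
    ext a
    exact ((agreeOn_reinterpret S d₀).atoms ⟨Q, a⟩ hQ).symm
  · obtain ⟨y⟩ := (inferInstance : Nonempty V)
    obtain ⟨x, hx, -⟩ := exists_injective_avoiding (Set.finite_empty (α := V)) Q.1
    -- The full relation, as the pullback of equality along identical terms; its complement is the
    -- empty interpretation of `Q`.
    have h := terms 2 Q.1 _ hH.equality (fun _ => .var y) x hx fun _ => d₀
    convert hH.compl _ _ h using 1
    ext a
    constructor
    · exact fun h => (hQ h.1).elim
    · exact fun h => (h rfl).elim

end Reinterpretation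

/-- Soundness is applied in the reinterpreted structure, where `H` is closed under every symbol that
the proof may mention, and the end sequent, being over `S`, is carried back along `AgreeOn`. -/
theorem Provable.henkinValid {L : FirstOrder.Language.{u, v}} {V : Type w} [Infinite V]
    {Γ Δ : Finset (IDFml L V)} (h : Provable Γ Δ) : HenkinValid.{u, v, w, d} Γ Δ := by
  intro D s val S H hS hH
  obtain ⟨y⟩ := (inferInstance : Nonempty V)
  have : Nonempty D := ⟨val y⟩
  have hag := agreeOn_reinterpret (s := s) S (val y)
  have hs := @Provable.sound L V D (reinterpret s S (val y)) _ _ Γ Δ h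
    (@IsHenkinClass.adequateSemantics L V D (reinterpret s S (val y)) _ H _ _
      (hH.reinterpret (val y))) val
  have hiff := fun φ hφ => hag.sat_iff (V := V)
    (e := fun Φ v => @Definition.HenkinModel L V D s H Φ _ v)
    (e' := fun Φ v => @Definition.HenkinModel L V D (reinterpret s S (val y)) H Φ _ v)
    (fun Φ hΦ v => ⟨hag.henkinModel hΦ, hag.symm.henkinModel hΦ⟩) φ (hS φ hφ) (v := val)
  rw [sequentSat_iff] at hs ⊢
  intro hΓ
  obtain ⟨φ, hφ, hsat⟩ := hs fun φ hφ =>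
    (hiff φ (Finset.mem_union_left _ hφ)).1 (hΓ φ hφ)
  exact ⟨φ, hφ, (hiff φ (Finset.mem_union_right _ hφ)).2 hsat⟩

end

end FOID

universe u v w d

theorem mainTheorem1 {L : FirstOrder.Language.{u, v}} {V : Type w} [Infinite V]
    (Γ Δ : Finset (FOID.IDFml L V)) (h : FOID.Provable Γ Δ) :
    FOID.WFValid.{u, v, w, d} Γ Δ ∧ FOID.StableValid.{u, v, w, d} Γ Δ ∧
      FOID.HenkinValid.{u, v, w, d} Γ Δ :=
  ⟨fun _ _ => h.sound (FOID.adequateSemantics_wellFounded _),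
    fun _ _ => h.sound (FOID.adequateSemantics_stable _), h.henkinValid⟩
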